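/- For $0<\alpha\le 1$ let $\mathbb{T}^2_\alpha=[0,2\pi/\alpha]\times[0,2\pi]$ be the elongated torus (opposite sides identified), and let $\dot H^1(\mathbb{T}^2_\alpha)$ be the Sobolev space of complex-valued periodic functions $\psi\in L_2(\mathbb{T}^2_\alpha)$ with weak gradient $\nabla\psi\in L_2(\mathbb{T}^2_\alpha)$ and with $\int_{\mathbb{T}^2_\alpha}\psi\,dx=0$. Let $\mathrm{k}_{\mathrm{LT}}(\mathbb{T}^2_\alpha)\in[0,\infty]$ be the Lieb–Thirring constant, that is, the infimum of all $\mathrm{k}\in[0,\infty]$ such that $$\int_{\mathbb{T}^2_\alpha}\Bigl(\sum_{j=1}^N|\psi_j(x)|^2\Bigr)^2dx\le \mathrm{k}\sum_{j=1}^N\|\nabla\psi_j\|^2_{L_2(\mathbb{T}^2_\alpha)}$$ for every $N$ and every family $\psi_1,\dots,\psi_N\in\dot H^1(\mathbb{T}^2_\alpha)$ that is orthonormal in $L_2(\mathbb{T}^2_\alpha)$. Then for every $\alpha\in(0,1]$ the displayed inequality holds with $\mathrm{k}=\frac1\alpha\,\frac{3\pi}{32}$ for all such families; in particular $$\mathrm{k}_{\mathrm{LT}}(\mathbb{T}^2_\alpha)\le\frac1\alpha\,\frac{3\pi}{32}.$$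 -/

import Mathlib

open MeasureTheory Set
open scoped ENNReal ContDiff ComplexConjugate

namespace LiebThirring

/-- The period cell `[0, 2π/α] × [0, 2π]` of the elongated torus. -/
def cell (α : ℝ) : Set (ℝ × ℝ) :=
  Icc 0 (2 * Real.pi / α) ×ˢ Icc 0 (2 * Real.pi)

/-- Lebesgue measure on the elongated torus, carried by its period cell. -/
noncomputable def torusMeasure (α : ℝ) : Measure (ℝ × ℝ) :=
  volume.restrict (cell α)

/-- Smooth functions on the elongated torus: smooth functions on the plane which are periodic
with period `2π/α` in the first variable and `2π` in the second one. -/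
structure IsTestFunction (α : ℝ) (φ : ℝ × ℝ → ℂ) : Prop where
  smooth : ContDiff ℝ ∞ φ
  periodic_fst : ∀ x : ℝ × ℝ, φ (x.1 + 2 * Real.pi / α, x.2) = φ x
  periodic_snd : ∀ x : ℝ × ℝ, φ (x.1, x.2 + 2 * Real.pi) = φ x

/-- `ψ` belongs to the Sobolev space `H¹` of the elongated torus and its weak gradient is
`(g₁, g₂)`. All functions matter only almost everywhere on the period cell; since the test
functions are periodic rather than compactly supported inside the cell, the weak derivatives
are those on the torus. -/
structure IsSobolev (α : ℝ) (ψ g₁ g₂ : ℝ × ℝ → ℂ) : Prop where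
  memLp : MemLp ψ 2 (torusMeasure α)
  memLp_fst : MemLp g₁ 2 (torusMeasure α)
  memLp_snd : MemLp g₂ 2 (torusMeasure α)
  weak_fst : ∀ φ : ℝ × ℝ → ℂ, IsTestFunction α φ →
    ∫ x, ψ x * fderiv ℝ φ x (1, 0) ∂(torusMeasure α) = - ∫ x, g₁ x * φ x ∂(torusMeasure α)
  weak_snd : ∀ φ : ℝ × ℝ → ℂ, IsTestFunction α φ →
    ∫ x, ψ x * fderiv ℝ φ x (0, 1) ∂(torusMeasure α) = - ∫ x, g₂ x * φ x ∂(torusMeasure α)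

/-- `ψ 0, …, ψ (N - 1)` is a family of mean zero functions in `H¹` of the elongated torus, with
weak gradients `(g₁ j, g₂ j)`, which is orthonormal in `L²`. -/
structure IsAdmissibleFamily (α : ℝ) {N : ℕ} (ψ g₁ g₂ : Fin N → ℝ × ℝ → ℂ) : Prop where
  sobolev : ∀ j, IsSobolev α (ψ j) (g₁ j) (g₂ j)
  mean_zero : ∀ j, ∫ x, ψ j x ∂(torusMeasure α) = 0
  orthonormal : ∀ i j,
    ∫ x, ψ i x * conj (ψ j x) ∂(torusMeasure α) = if i = j then 1 else 0

/-- The Lieb–Thirring inequality `∫ ρ² ≤ k ∑ⱼ ‖∇ψⱼ‖²`, `ρ = ∑ⱼ |ψⱼ|²`, holds with constant `k`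
for all finite orthonormal families of mean zero `H¹` functions on the elongated torus. -/
def LiebThirringInequality (α : ℝ) (k : ℝ≥0∞) : Prop :=
  ∀ (N : ℕ) (ψ g₁ g₂ : Fin N → ℝ × ℝ → ℂ), IsAdmissibleFamily α ψ g₁ g₂ →
    ∫⁻ x, (∑ j, ‖ψ j x‖ₑ ^ 2) ^ 2 ∂(torusMeasure α) ≤
      k * ∑ j, ∫⁻ x, (‖g₁ j x‖ₑ ^ 2 + ‖g₂ j x‖ₑ ^ 2) ∂(torusMeasure α)

/-- The Lieb–Thirring constant of the elongated torus: the best constant in the inequality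
(`∞` if no finite constant works). -/
noncomputable def kLT (α : ℝ) : ℝ≥0∞ :=
  sInf {k : ℝ≥0∞ | LiebThirringInequality α k}

end LiebThirring

namespace LiebThirring

/-! The method is a smoothed energy cut-off, integrated over the cut-off level `ν`. Let `m_ν(l) = (1
+ l²/ν²)⁻¹` act as a Fourier multiplier on the spectrum of `-Δ`. By Bessel's inequality for the
orthonormal `ψ_j`, the low energy parts satisfy `∑ |m_ν ψ_j (x)|² ≤ (α/4π²) ∑_{k≠0} m_ν(l_k)² ≤ A ν`
almost everywhere, with `A = 1/(16α)`. The `ℓ²` triangle inequality then bounds `(√ρ - √(Aν))₊²` by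
the density of the high energy parts. Integrating in `x` and in `ν`, the left side gives `∫ ρ² /
(6A)`; the right side gives `(π/4) ∑ ‖∇ψ_j‖²`, since `∫₀^∞ (1 - m_ν(l))² dν = π l / 4`. The constant
is `6A · π/4 = 3π/(32α)` (`lintegral_density_sq_le`).

The hard input is the sharp Weyl-type bound `sum_lattice_le`: on `ℤ² \ {0}` the sum of `(1 +
|k|⁴/ν²)⁻²` is at most the corresponding integral over the plane, `π²ν/4`. For small `ν` a crude
bound by `∑ |k|⁻⁴` suffices. For large `ν` the summand is written as a Laplace integral of
`exp(-|k|² t)` along the ray of direction `1 + i`, and Poisson summation is applied to the resulting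
theta function. The zero Poisson mode yields exactly the plane integral and the other modes yield an
error of order `1/ν`. That error is below `1`, the value of the omitted term `k = 0`.

The torus enters through the Hilbert basis of exponentials and Parseval's identity
(`IsSobolev.tsum_eigenvalue_mul`); the comparison `l_k ≥ α²|k|²` reduces the elongated lattice to
the square one. -/

/-! ### Laplace representation of the squared multiplier on a complex ray. -/

lemma integrableOn_affine_mul_exp (a b : ℝ) {x : ℝ} (hx : 0 < x) :
    IntegrableOn (fun τ : ℝ => (a + b * τ) * Real.exp (-(x * τ))) (Ioi 0) := by
  have h0 : IntegrableOn (fun τ : ℝ => Real.exp (-(x * τ))) (Ioi 0) := by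
    have := integrableOn_rpow_mul_exp_neg_mul_rpow (s := 0) (p := 1) (b := x)
      (by norm_num) one_pos hx
    simpa using this
  have h1 : IntegrableOn (fun τ : ℝ => τ * Real.exp (-(x * τ))) (Ioi 0) := by
    have := integrableOn_rpow_mul_exp_neg_mul_rpow (s := 1) (p := 1) (b := x)
      (by norm_num) one_pos hx
    simpa using this
  refine ((h0.const_mul a).add (h1.const_mul b)).congr (.of_forall fun τ => ?_)
  simp only [Pi.add_apply]
  ring

lemma integrableOn_affine_mul_cexp (a b : ℂ) {z : ℂ} (hz : 0 < z.re) :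
    IntegrableOn (fun τ : ℝ => (a + b * τ) * Complex.exp (-(z * τ))) (Ioi 0) := by
  refine (integrableOn_affine_mul_exp ‖a‖ ‖b‖ hz).mono'
    (Continuous.aestronglyMeasurable (by fun_prop)) ?_
  filter_upwards [ae_restrict_mem measurableSet_Ioi] with τ hτ
  have hτ : 0 < τ := hτ
  rw [norm_mul, Complex.norm_exp]
  have : (-(z * (τ : ℂ))).re = -(z.re * τ) := by simp
  rw [this]
  gcongr
  refine (norm_add_le _ _).trans ?_
  rw [norm_mul, Complex.norm_real, Real.norm_of_nonneg hτ.le]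

/-- `∫₀^∞ (a + b τ) e^{-zτ} dτ = a / z + b / z²`. -/
lemma integral_affine_mul_cexp (a b : ℂ) {z : ℂ} (hz : 0 < z.re) :
    ∫ τ in Ioi (0 : ℝ), (a + b * τ) * Complex.exp (-(z * τ)) = a / z + b / z ^ 2 := by
  have hz0 : z ≠ 0 := by rintro rfl; simp at hz
  have hderiv : ∀ τ ∈ Ioi (0 : ℝ),
      HasDerivAt (fun τ : ℝ => -((a + b * τ) / z + b / z ^ 2) * Complex.exp (-(z * τ)))
        ((a + b * τ) * Complex.exp (-(z * τ))) τ := by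
    intro τ _
    have h1 : HasDerivAt (fun τ : ℝ => (τ : ℂ)) 1 τ := Complex.ofRealCLM.hasDerivAt
    have h2 : HasDerivAt (fun τ : ℝ => -((a + b * τ) / z + b / z ^ 2)) (-(b * 1 / z)) τ :=
      ((((h1.const_mul b).const_add a).div_const z).add_const _).neg
    have h3 : HasDerivAt (fun τ : ℝ => Complex.exp (-(z * τ)))
        (Complex.exp (-(z * τ)) * (-(z * 1))) τ := (h1.const_mul z).neg.cexp
    convert! h2.mul h3 using 1
    field_simp
    ring
  have hlim : Filter.Tendsto
      (fun τ : ℝ => -((a + b * τ) / z + b / z ^ 2) * Complex.exp (-(z * τ)))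
      Filter.atTop (nhds 0) := by
    have e0 : Filter.Tendsto (fun τ : ℝ => Real.exp (-(z.re * τ))) Filter.atTop (nhds 0) := by
      have := tendsto_rpow_mul_exp_neg_mul_atTop_nhds_zero 0 z.re hz
      simpa using this
    have e1 : Filter.Tendsto (fun τ : ℝ => τ * Real.exp (-(z.re * τ))) Filter.atTop (nhds 0) := by
      have := tendsto_rpow_mul_exp_neg_mul_atTop_nhds_zero 1 z.re hz
      simpa using this
    have c0 : Filter.Tendsto (fun τ : ℝ => Complex.exp (-(z * τ))) Filter.atTop (nhds 0) := by
      rw [tendsto_zero_iff_norm_tendsto_zero]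
      refine e0.congr fun τ => ?_
      rw [Complex.norm_exp]; simp
    have c1 : Filter.Tendsto (fun τ : ℝ => (τ : ℂ) * Complex.exp (-(z * τ)))
        Filter.atTop (nhds 0) := by
      rw [tendsto_zero_iff_norm_tendsto_zero]
      refine (e1.congr' ?_)
      filter_upwards [Filter.eventually_ge_atTop 0] with τ hτ
      rw [norm_mul, Complex.norm_exp, Complex.norm_real, Real.norm_of_nonneg hτ]; simp
    have := (c0.const_mul (-(a / z + b / z ^ 2))).add (c1.const_mul (-(b / z)))
    simp only [mul_zero, add_zero] at this
    refine this.congr fun τ => ?_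
    field_simp
    ring
  rw [integral_Ioi_of_hasDerivAt_of_tendsto
    (Continuous.continuousWithinAt (by fun_prop)) hderiv
    (integrableOn_affine_mul_cexp a b hz) hlim]
  simp

/-- The Laplace density of `s ↦ ν² (1 + s² / ν²)⁻²` on the ray of direction `1 + i`. -/
noncomputable def rayWeight (ν τ : ℝ) : ℂ :=
  (Complex.I / ν + τ * (1 + Complex.I)) * (1 + Complex.I) *
    Complex.exp (Complex.I * ν * (τ * (1 + Complex.I)))

/-- A point of the ray of direction `1 + i` starting from `ε`. -/
noncomputable def rayPoint (ε τ : ℝ) : ℂ := ε + τ * (1 + Complex.I)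

lemma continuous_rayWeight (ν : ℝ) : Continuous (rayWeight ν) := by
  unfold rayWeight; fun_prop

lemma norm_one_add_I : ‖(1 + Complex.I : ℂ)‖ = √2 := by
  rw [Complex.norm_def, Complex.normSq_apply]; norm_num

lemma norm_rayWeight_le {ν τ : ℝ} (hν : 0 < ν) (hτ : 0 ≤ τ) :
    ‖rayWeight ν τ‖ ≤ (√2 / ν + 2 * τ) * Real.exp (-(ν * τ)) := by
  unfold rayWeight
  rw [norm_mul, norm_mul, Complex.norm_exp, norm_one_add_I]
  have : (Complex.I * ν * (τ * (1 + Complex.I))).re = -(ν * τ) := by simp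
  rw [this]
  gcongr
  have h := norm_add_le (Complex.I / (ν : ℂ)) (τ * (1 + Complex.I))
  rw [norm_div, norm_mul, Complex.norm_I, norm_one_add_I, Complex.norm_real, Complex.norm_real,
    Real.norm_of_nonneg hν.le, Real.norm_of_nonneg hτ] at h
  have h2 : √2 * √2 = 2 := Real.mul_self_sqrt (by norm_num)
  calc _ ≤ (1 / ν + τ * √2) * √2 := by gcongr
    _ = √2 / ν + (√2 * √2) * τ := by ring
    _ = _ := by rw [h2]

lemma integrableOn_norm_rayWeight {ν : ℝ} (hν : 0 < ν) :
    IntegrableOn (fun τ => ‖rayWeight ν τ‖) (Ioi 0) := by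
  refine (integrableOn_affine_mul_exp (√2 / ν) 2 hν).mono'
    (continuous_rayWeight ν).norm.aestronglyMeasurable ?_
  filter_upwards [ae_restrict_mem measurableSet_Ioi] with τ hτ
  rw [norm_norm]
  exact norm_rayWeight_le hν (le_of_lt hτ)

lemma norm_exp_neg_mul_rayPoint {s ε τ : ℝ} :
    ‖Complex.exp (-(s * rayPoint ε τ))‖ = Real.exp (-(s * (ε + τ))) := by
  rw [Complex.norm_exp]
  congr 1
  simp [rayPoint]

lemma continuous_rayPoint (ε : ℝ) : Continuous (rayPoint ε) := by
  unfold rayPoint; fun_prop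

/-- The ray integral equals `exp(-sε) (i/(ν(s - iν)) + 1/(s - iν)²)`, and the bracket has real part
`-2ν²/(s² + ν²)²`. On the real axis `exp(iνz)` only oscillates; along direction `1 + i` it decays
like `exp(-ντ)`. -/
lemma exp_mul_eq_integral_rayWeight {ν s : ℝ} (hν : 0 < ν) (hs : 0 ≤ s) (ε : ℝ) :
    Real.exp (-(s * ε)) * (1 + s ^ 2 / ν ^ 2)⁻¹ ^ 2 =
      -(ν ^ 2 / 2) *
        (∫ τ in Ioi (0 : ℝ), rayWeight ν τ * Complex.exp (-(s * rayPoint ε τ))).re := by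
  have hz : 0 < ((1 + Complex.I) * (s - Complex.I * ν)).re := by
    simp; linarith
  have hI := integral_affine_mul_cexp (Complex.I / ν * (1 + Complex.I)) ((1 + Complex.I) ^ 2) hz
  have heq : ∀ τ : ℝ, rayWeight ν τ * Complex.exp (-(s * rayPoint ε τ)) =
      Complex.exp (-(s * ε)) * ((Complex.I / ν * (1 + Complex.I) + (1 + Complex.I) ^ 2 * τ) *
        Complex.exp (-((1 + Complex.I) * (s - Complex.I * ν) * τ))) := by
    intro τ
    have : Complex.exp (-(s * rayPoint ε τ)) * Complex.exp (Complex.I * ν * (τ * (1 + Complex.I))) =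
        Complex.exp (-(s * ε)) * Complex.exp (-((1 + Complex.I) * (s - Complex.I * ν) * τ)) := by
      rw [← Complex.exp_add, ← Complex.exp_add]
      congr 1
      unfold rayPoint
      ring
    unfold rayWeight
    linear_combination
      ((Complex.I / ν + τ * (1 + Complex.I)) * (1 + Complex.I)) * this
  simp_rw [heq]
  rw [integral_const_mul, hI]
  have hne : (s - Complex.I * ν : ℂ) ≠ 0 := by
    intro h
    have := congrArg Complex.im h
    simp at this
    exact hν.ne' this
  have hne' : (s + Complex.I * ν : ℂ) ≠ 0 := by
    intro h
    have := congrArg Complex.im h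
    simp at this
    exact hν.ne' this
  have h1I : (1 + Complex.I : ℂ) ≠ 0 := by
    intro h
    have := congrArg Complex.re h
    simp at this
  have hνc : (ν : ℂ) ≠ 0 := by exact_mod_cast hν.ne'
  have hpos : 0 < s ^ 2 + ν ^ 2 := by positivity
  have hposc : ((s ^ 2 + ν ^ 2 : ℝ) : ℂ) ≠ 0 := by exact_mod_cast hpos.ne'
  have hprod : (s - Complex.I * ν) * (s + Complex.I * ν) = ((s ^ 2 + ν ^ 2 : ℝ) : ℂ) := by
    push_cast
    linear_combination (-(ν : ℂ) ^ 2) * Complex.I_sq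
  have hinv : (s - Complex.I * ν : ℂ)⁻¹ = (s + Complex.I * ν) * (((s ^ 2 + ν ^ 2)⁻¹ : ℝ) : ℂ) := by
    rw [inv_eq_iff_eq_inv, mul_inv, Complex.ofReal_inv, inv_inv, ← hprod]
    field_simp
  have hval : Complex.I / ν * (1 + Complex.I) / ((1 + Complex.I) * (s - Complex.I * ν)) +
      (1 + Complex.I) ^ 2 / ((1 + Complex.I) * (s - Complex.I * ν)) ^ 2 =
      Complex.I * ((ν⁻¹ : ℝ) : ℂ) * (s - Complex.I * ν : ℂ)⁻¹ + (s - Complex.I * ν : ℂ)⁻¹ ^ 2 := by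
    push_cast
    field_simp
  have hexp : Complex.exp (-((s : ℂ) * ε)) = (Real.exp (-(s * ε)) : ℂ) := by push_cast; rfl
  rw [hval, hinv, hexp, Complex.re_ofReal_mul]
  have : (Complex.I * ((ν⁻¹ : ℝ) : ℂ) * ((s + Complex.I * ν) * (((s ^ 2 + ν ^ 2)⁻¹ : ℝ) : ℂ)) +
      ((s + Complex.I * ν) * (((s ^ 2 + ν ^ 2)⁻¹ : ℝ) : ℂ)) ^ 2).re =
      -(s ^ 2 + ν ^ 2)⁻¹ + (s ^ 2 - ν ^ 2) * (s ^ 2 + ν ^ 2)⁻¹ ^ 2 := by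
    simp only [pow_two, Complex.add_re, Complex.mul_re, Complex.mul_im, Complex.I_re, Complex.I_im,
      Complex.ofReal_re, Complex.ofReal_im, Complex.add_im]
    field_simp
    ring
  rw [this]
  field_simp
  ring

/-! ### Theta series of the square lattice and Poisson summation. -/

lemma summable_exp_neg_mul_int_sq {r : ℝ} (hr : 0 < r) :
    Summable (fun n : ℤ => Real.exp (-(r * (n : ℝ) ^ 2))) := by
  have h2 : Summable (fun n : ℤ => 1 / (n : ℝ) ^ 2) :=
    Real.summable_one_div_int_pow.mpr (by norm_num)
  have h1 : Summable (fun n : ℤ => if n = 0 then (1 : ℝ) else 0) :=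
    summable_of_hasFiniteSupport
      ((finite_singleton (0 : ℤ)).subset (Function.support_subset_iff'.mpr (by
        intro x hx; simp at hx; simp [hx])))
  refine Summable.of_nonneg_of_le (fun _ => (Real.exp_pos _).le) (fun n => ?_)
    ((h2.mul_left (1 / r)).add h1)
  by_cases hn : n = 0
  · simp [hn]
  · have hn' : (0 : ℝ) < (n : ℝ) ^ 2 := by positivity
    simp only [hn, if_false, add_zero]
    rw [Real.exp_neg, ← one_div, one_div_mul_one_div]
    refine one_div_le_one_div_of_le (by positivity) ?_
    linarith [Real.add_one_le_exp (r * (n : ℝ) ^ 2)]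

/-- The squared length of an integer vector. -/
def latticeSq (k : ℤ × ℤ) : ℝ := (k.1 : ℝ) ^ 2 + (k.2 : ℝ) ^ 2

lemma latticeSq_nonneg (k : ℤ × ℤ) : 0 ≤ latticeSq k := by unfold latticeSq; positivity

lemma latticeSq_pos {k : ℤ × ℤ} (hk : k ≠ 0) : 0 < latticeSq k := by
  unfold latticeSq
  rcases eq_or_ne k.1 0 with h1 | h1
  · have h2 : k.2 ≠ 0 := fun h2 => hk (Prod.ext h1 h2)
    positivity
  · positivity

lemma summable_exp_neg_mul_latticeSq {r : ℝ} (hr : 0 < r) :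
    Summable (fun k : ℤ × ℤ => Real.exp (-(r * latticeSq k))) := by
  have h := summable_exp_neg_mul_int_sq hr
  refine (h.mul_of_nonneg h (fun _ => (Real.exp_pos _).le) (fun _ => (Real.exp_pos _).le)).congr
    fun k => ?_
  rw [← Real.exp_add]
  congr 1
  unfold latticeSq
  ring

lemma summable_cexp_neg_mul_latticeSq {t : ℂ} (ht : 0 < t.re) :
    Summable (fun k : ℤ × ℤ => Complex.exp (-(latticeSq k * t))) := by
  refine .of_norm ((summable_exp_neg_mul_latticeSq ht).congr fun k => ?_)
  rw [Complex.norm_exp]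
  congr 1
  simp [mul_comm]

lemma tsum_cexp_neg_mul_latticeSq {t : ℂ} (ht : 0 < t.re) :
    ∑' k : ℤ × ℤ, Complex.exp (-(latticeSq k * t)) =
      (∑' n : ℤ, Complex.exp (-((n : ℂ) ^ 2 * t))) ^ 2 := by
  have hs : Summable (fun n : ℤ => ‖Complex.exp (-((n : ℂ) ^ 2 * t))‖) := by
    refine (summable_exp_neg_mul_int_sq ht).congr fun n => ?_
    rw [Complex.norm_exp]
    congr 1
    have : ((n : ℂ) ^ 2) = (((n : ℝ) ^ 2 : ℝ) : ℂ) := by push_cast; rfl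
    rw [this, Complex.neg_re, Complex.re_ofReal_mul, mul_comm]
  rw [pow_two, tsum_mul_tsum_of_summable_norm hs hs]
  refine tsum_congr fun k => ?_
  rw [← Complex.exp_add]
  congr 1
  unfold latticeSq
  push_cast
  ring

/-- Poisson summation for the complex Gaussian on `ℤ²`. -/
lemma tsum_cexp_neg_mul_latticeSq_inversion {t : ℂ} (ht : 0 < t.re) :
    ∑' k : ℤ × ℤ, Complex.exp (-(latticeSq k * t)) =
      Real.pi / t * ∑' k : ℤ × ℤ, Complex.exp (-(latticeSq k * (Real.pi ^ 2 / t))) := by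
  have ht0 : t ≠ 0 := by rintro rfl; simp at ht
  have hπ : (Real.pi : ℂ) ≠ 0 := by exact_mod_cast Real.pi_ne_zero
  have hinv : 0 < ((Real.pi : ℂ) ^ 2 / t).re := by
    have : ((Real.pi : ℂ) ^ 2 / t) = ((Real.pi ^ 2 : ℝ) : ℂ) * t⁻¹ := by push_cast; rfl
    rw [this, Complex.re_ofReal_mul, Complex.inv_re]
    have := Complex.normSq_pos.mpr ht0
    positivity
  have ha : 0 < (t / Real.pi).re := by
    rw [Complex.div_ofReal_re]; positivity
  rw [tsum_cexp_neg_mul_latticeSq ht, tsum_cexp_neg_mul_latticeSq hinv]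
  have h := Complex.tsum_exp_neg_mul_int_sq ha
  have e1 : ∀ n : ℤ, -(Real.pi : ℂ) * (t / Real.pi) * (n : ℂ) ^ 2 = -((n : ℂ) ^ 2 * t) := by
    intro n; field_simp
  have e2 : ∀ n : ℤ, -(Real.pi : ℂ) / (t / Real.pi) * (n : ℂ) ^ 2 =
      -((n : ℂ) ^ 2 * (Real.pi ^ 2 / t)) := by
    intro n; field_simp
  simp_rw [e1, e2] at h
  rw [h, mul_pow]
  congr 1
  rw [div_pow, one_pow, ← Complex.cpow_nat_mul]
  norm_num

/-- The function `x² exp(-x)` has its maximum `4 exp(-2)` at `x = 2`; squaring `1 + y ≤ exp y` at `y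
= x/2 - 1` gives this sharp constant. -/
lemma sq_mul_exp_neg_le {x : ℝ} (hx : 0 < x) : Real.exp (-x) ≤ 4 * Real.exp (-2) / x ^ 2 := by
  have h := Real.add_one_le_exp (x / 2 - 1)
  have h' : x / 2 ≤ Real.exp (x / 2 - 1) := by linarith
  have h2 : (x / 2) ^ 2 ≤ Real.exp (x / 2 - 1) ^ 2 := by gcongr
  rw [← Real.exp_nat_mul] at h2
  have e : Real.exp (-x) * Real.exp (((2 : ℕ) : ℝ) * (x / 2 - 1)) = Real.exp (-2) := by
    rw [← Real.exp_add]; congr 1; push_cast; ring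
  rw [le_div_iff₀ (by positivity), ← e]
  nlinarith [mul_le_mul_of_nonneg_left h2 (Real.exp_pos (-x)).le]

/-- The nonzero terms of the inverted theta series along the ray. -/
lemma norm_exp_inv_rayPoint_le {ε τ q : ℝ} (hε : 0 < ε) (hτ : 0 ≤ τ) (hq : 0 < q) :
    ‖Real.pi / rayPoint ε τ * Complex.exp (-(q * (Real.pi ^ 2 / rayPoint ε τ)))‖ ≤
      8 * √2 * Real.exp (-2) / Real.pi ^ 3 * (ε + τ) * (1 / q ^ 2) := by
  have hre : (rayPoint ε τ).re = ε + τ := by simp [rayPoint]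
  have him : (rayPoint ε τ).im = τ := by simp [rayPoint]
  have hns : Complex.normSq (rayPoint ε τ) = ‖rayPoint ε τ‖ ^ 2 := Complex.normSq_eq_norm_sq _
  have hn2 : ‖rayPoint ε τ‖ ^ 2 = (ε + τ) ^ 2 + τ ^ 2 := by
    rw [← hns, Complex.normSq_apply, hre, him]; ring
  set T := ‖rayPoint ε τ‖
  have hTpos : 0 < T := by
    rw [norm_pos_iff]; intro h0
    rw [h0] at hre; simp at hre; linarith
  -- The ray stays in the sector `|arg t| ≤ π/4`, so `Re (1/t)` remains comparable to `1/|t|` and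
  -- the inverted Gaussians still decay.
  have hTle : T ≤ √2 * (ε + τ) := by
    refine abs_le_of_sq_le_sq' ?_ (by positivity) |>.2
    rw [mul_pow, Real.sq_sqrt (by norm_num), hn2]
    nlinarith
  rw [norm_mul, norm_div, Complex.norm_exp, Complex.norm_real, Real.norm_of_nonneg Real.pi_pos.le]
  have hexp : (-((q : ℂ) * (Real.pi ^ 2 / rayPoint ε τ))).re =
      -(q * Real.pi ^ 2 * (ε + τ) / T ^ 2) := by
    have : -((q : ℂ) * (Real.pi ^ 2 / rayPoint ε τ)) =
      ((-(q * Real.pi ^ 2) : ℝ) : ℂ) * (rayPoint ε τ)⁻¹ := by push_cast; ring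
    rw [this, Complex.re_ofReal_mul, Complex.inv_re, hre, hns]
    ring
  rw [hexp]
  have hετ : 0 < ε + τ := by linarith
  calc Real.pi / T * Real.exp (-(q * Real.pi ^ 2 * (ε + τ) / T ^ 2))
      ≤ Real.pi / T * (4 * Real.exp (-2) / (q * Real.pi ^ 2 * (ε + τ) / T ^ 2) ^ 2) := by
        gcongr
        exact sq_mul_exp_neg_le (by positivity)
    _ = 4 * Real.exp (-2) / (Real.pi ^ 3 * q ^ 2 * (ε + τ) ^ 2) * T ^ 3 := by
        field_simp
    _ ≤ 4 * Real.exp (-2) / (Real.pi ^ 3 * q ^ 2 * (ε + τ) ^ 2) * (√2 * (ε + τ)) ^ 3 := by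
        gcongr
    _ = 4 * Real.exp (-2) / (Real.pi ^ 3 * q ^ 2 * (ε + τ) ^ 2) *
          (√2 ^ 2 * √2 * (ε + τ) ^ 3) := by ring
    _ = _ := by
        rw [Real.sq_sqrt (by norm_num)]
        field_simp
        ring

/-! ### The lattice sum of `|k|⁻⁴` and the case of small `ν`. -/

/-- Since `1 / 0 = 0`, the term `n = 0` contributes nothing and the value is `2 ζ(2)`. -/
lemma hasSum_int_inv_sq : HasSum (fun n : ℤ => 1 / (n : ℝ) ^ 2) (Real.pi ^ 2 / 3) := by
  have h := HasSum.of_nat_of_neg (f := fun n : ℤ => 1 / (n : ℝ) ^ 2)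
    (by simpa using hasSum_zeta_two) (by simpa using hasSum_zeta_two)
  convert! h using 1
  simp; ring

lemma hasSum_int_inv_pow_four : HasSum (fun n : ℤ => 1 / (n : ℝ) ^ 4) (Real.pi ^ 4 / 45) := by
  have he : ∀ n : ℕ, (-(n : ℝ)) ^ 4 = (n : ℝ) ^ 4 := fun n => by ring
  have h := HasSum.of_nat_of_neg (f := fun n : ℤ => 1 / (n : ℝ) ^ 4)
    (by simpa using hasSum_zeta_four) (by simpa [he] using hasSum_zeta_four)
  convert! h using 1
  simp; ring

/-- A summable majorant of `|k|⁻⁴`, from `1 / (m² + n²)² ≤ 1 / (4 m² n²)`. -/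
noncomputable def latticeMajorant (k : ℤ × ℤ) : ℝ :=
  1 / 4 * (1 / (k.1 : ℝ) ^ 2 * (1 / (k.2 : ℝ) ^ 2)) +
    (1 / (k.1 : ℝ) ^ 4 * (if k.2 = 0 then 1 else 0) +
      (if k.1 = 0 then 1 else 0) * (1 / (k.2 : ℝ) ^ 4))

lemma summable_mul_int_of_nonneg {f g : ℤ → ℝ} (hf : Summable f) (hg : Summable g)
    (pf : ∀ n, 0 ≤ f n) (pg : ∀ n, 0 ≤ g n) : Summable fun k : ℤ × ℤ => f k.1 * g k.2 :=
  hf.mul_of_nonneg hg pf pg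

/-- With `1 / 0 = 0` the product term lives off the axes and the other two on the axes, so the sum
splits into `(2ζ(2))²/4 + 2 · 2ζ(4) = π⁴/36 + 2π⁴/45`. -/
lemma hasSum_latticeMajorant : HasSum latticeMajorant (13 * Real.pi ^ 4 / 180) := by
  obtain ⟨f2, hf2⟩ : ∃ f : ℤ → ℝ, f = fun n : ℤ => 1 / (n : ℝ) ^ 2 := ⟨_, rfl⟩
  obtain ⟨f4, hf4⟩ : ∃ f : ℤ → ℝ, f = fun n : ℤ => 1 / (n : ℝ) ^ 4 := ⟨_, rfl⟩
  obtain ⟨f0, hf0⟩ : ∃ f : ℤ → ℝ, f = fun n : ℤ => if n = 0 then (1 : ℝ) else 0 := ⟨_, rfl⟩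
  have h2 : HasSum f2 (Real.pi ^ 2 / 3) := hf2 ▸ hasSum_int_inv_sq
  have h4 : HasSum f4 (Real.pi ^ 4 / 45) := hf4 ▸ hasSum_int_inv_pow_four
  have h0 : HasSum f0 1 := hf0 ▸ hasSum_ite_eq 0 1
  have p2 : ∀ n : ℤ, 0 ≤ f2 n := fun n => by rw [hf2]; positivity
  have p4 : ∀ n : ℤ, 0 ≤ f4 n := fun n => by rw [hf4]; positivity
  have p0 : ∀ n : ℤ, 0 ≤ f0 n := fun n => by rw [hf0]; dsimp only; split_ifs <;> norm_num
  have a := (h2.mul h2 (summable_mul_int_of_nonneg h2.summable h2.summable p2 p2)).mul_left (1 / 4)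
  have b := h4.mul h0 (summable_mul_int_of_nonneg h4.summable h0.summable p4 p0)
  have c := h0.mul h4 (summable_mul_int_of_nonneg h0.summable h4.summable p0 p4)
  have e : 13 * Real.pi ^ 4 / 180 = 1 / 4 * (Real.pi ^ 2 / 3 * (Real.pi ^ 2 / 3)) +
      (Real.pi ^ 4 / 45 * 1 + 1 * (Real.pi ^ 4 / 45)) := by ring
  rw [e]
  refine (a.add (b.add c)).congr_fun fun k => ?_
  simp only [latticeMajorant, hf2, hf4, hf0]

lemma latticeMajorant_nonneg (k : ℤ × ℤ) : 0 ≤ latticeMajorant k := by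
  unfold latticeMajorant; positivity

lemma one_div_latticeSq_sq_le (k : ℤ × ℤ) : 1 / latticeSq k ^ 2 ≤ latticeMajorant k := by
  obtain ⟨m, n⟩ := k
  unfold latticeMajorant latticeSq
  by_cases hm : m = 0
  · by_cases hn : n = 0
    · simp [hm, hn]
    · simp [hm, hn]
      rw [← pow_mul]
  · by_cases hn : n = 0
    · simp [hm, hn]
      rw [← pow_mul]
    · have hm' : (0 : ℝ) < (m : ℝ) ^ 2 := by positivity
      have hn' : (0 : ℝ) < (n : ℝ) ^ 2 := by positivity
      simp only [hm, hn, if_false, mul_zero, zero_mul, add_zero]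
      rw [one_div_mul_one_div, one_div_mul_one_div]
      refine one_div_le_one_div_of_le (by positivity) ?_
      nlinarith [sq_nonneg ((m : ℝ) ^ 2 - (n : ℝ) ^ 2)]

/-- The lattice sum estimate for small `ν`. -/
lemma sum_lattice_le_of_le {ν : ℝ} (hν : 0 < ν) (hν' : ν ≤ 13 / 10) (K : Finset (ℤ × ℤ))
    (hK : 0 ∉ K) :
    ∑ k ∈ K, (1 + latticeSq k ^ 2 / ν ^ 2)⁻¹ ^ 2 ≤ Real.pi ^ 2 / 4 * ν := by
  have hterm : ∀ k ∈ K, (1 + latticeSq k ^ 2 / ν ^ 2)⁻¹ ^ 2 ≤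
      ν ^ 2 / 4 * latticeMajorant k := by
    intro k hk
    have hq := latticeSq_pos (k := k) (by rintro rfl; exact hK hk)
    refine le_trans ?_ (mul_le_mul_of_nonneg_left (one_div_latticeSq_sq_le k) (by positivity))
    set q := latticeSq k
    -- The arithmetic-geometric mean inequality turns each summand into `ν² / (4 q²)`, which is
    -- quadratic in `ν` and so beats the linear bound for small `ν`.
    have h1 : 2 * (q / ν) ≤ 1 + q ^ 2 / ν ^ 2 := by
      rw [← div_pow]; nlinarith [sq_nonneg (q / ν - 1)]
    calc (1 + q ^ 2 / ν ^ 2)⁻¹ ^ 2 ≤ (2 * (q / ν))⁻¹ ^ 2 := by gcongr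
      _ = _ := by field_simp; norm_num
  calc ∑ k ∈ K, (1 + latticeSq k ^ 2 / ν ^ 2)⁻¹ ^ 2 ≤ ∑ k ∈ K, ν ^ 2 / 4 * latticeMajorant k :=
        Finset.sum_le_sum hterm
    _ = ν ^ 2 / 4 * ∑ k ∈ K, latticeMajorant k := by rw [Finset.mul_sum]
    _ ≤ ν ^ 2 / 4 * (13 * Real.pi ^ 4 / 180) := by
        gcongr
        exact sum_le_hasSum K (fun k _ => latticeMajorant_nonneg k) hasSum_latticeMajorant
    _ = Real.pi ^ 2 / 4 * ν * (13 * Real.pi ^ 2 / 180 * ν) := by ring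
    _ ≤ Real.pi ^ 2 / 4 * ν * 1 := by
        gcongr
        have := Real.pi_lt_d2
        have h2 : Real.pi ^ 2 ≤ 3.15 ^ 2 := by gcongr
        calc 13 * Real.pi ^ 2 / 180 * ν ≤ 13 * 3.15 ^ 2 / 180 * (13 / 10) := by gcongr
          _ ≤ 1 := by norm_num
    _ = _ := mul_one _

/-! ### Main term, theta error and the case of large `ν`. -/

lemma hasDerivAt_lorentz_sq_primitive {ν : ℝ} (hν : 0 < ν) (s : ℝ) :
    HasDerivAt (fun s : ℝ => ν / 2 * (Real.arctan (s / ν) + s / ν * (1 + s ^ 2 / ν ^ 2)⁻¹))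
      ((1 + s ^ 2 / ν ^ 2)⁻¹ ^ 2) s := by
  have h1 : HasDerivAt (fun s : ℝ => s / ν) (1 / ν) s := (hasDerivAt_id s).div_const ν
  have h2 : HasDerivAt (fun s : ℝ => 1 + s ^ 2 / ν ^ 2) ((2 * s) / ν ^ 2) s := by
    simpa using ((hasDerivAt_pow 2 s).div_const (ν ^ 2)).const_add 1
  have hpos : (0 : ℝ) < 1 + s ^ 2 / ν ^ 2 := by positivity
  have h3 := h2.fun_inv hpos.ne'
  convert! ((h1.arctan.add (h1.mul h3)).const_mul (ν / 2)) using 1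
  rw [div_pow]
  field_simp
  ring

lemma tendsto_lorentz_sq_primitive {ν : ℝ} (hν : 0 < ν) :
    Filter.Tendsto (fun s : ℝ => ν / 2 * (Real.arctan (s / ν) + s / ν * (1 + s ^ 2 / ν ^ 2)⁻¹))
      Filter.atTop (nhds (Real.pi * ν / 4)) := by
  have h1 : Filter.Tendsto (fun s : ℝ => s / ν) Filter.atTop Filter.atTop :=
    Filter.tendsto_id.atTop_div_const hν
  have h2 : Filter.Tendsto (fun x : ℝ => x * (1 + x ^ 2)⁻¹) Filter.atTop (nhds 0) := by
    refine squeeze_zero' ?_ ?_ tendsto_inv_atTop_zero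
    · filter_upwards [Filter.eventually_ge_atTop 0] with x hx
      positivity
    · filter_upwards [Filter.eventually_gt_atTop 0] with x hx
      rw [← div_eq_mul_inv, div_le_iff₀ (by positivity), mul_add, pow_two,
        inv_mul_cancel_left₀ hx.ne']
      have : 0 < x⁻¹ * 1 := by positivity
      linarith
  have h3 : Filter.Tendsto Real.arctan Filter.atTop (nhds (Real.pi / 2)) :=
    Real.tendsto_arctan_atTop.mono_right nhdsWithin_le_nhds
  have h := ((h3.add h2).comp h1).const_mul (ν / 2)
  convert! h using 2
  · simp [div_pow]
  · ring

lemma integrableOn_lorentz_sq {ν : ℝ} (hν : 0 < ν) :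
    IntegrableOn (fun s : ℝ => (1 + s ^ 2 / ν ^ 2)⁻¹ ^ 2) (Ioi 0) :=
  integrableOn_Ioi_deriv_of_nonneg
    (hasDerivAt_lorentz_sq_primitive hν 0).continuousAt.continuousWithinAt
    (fun s _ => hasDerivAt_lorentz_sq_primitive hν s) (fun s _ => by positivity)
    (tendsto_lorentz_sq_primitive hν)

lemma integral_lorentz_sq {ν : ℝ} (hν : 0 < ν) :
    ∫ s in Ioi (0 : ℝ), (1 + s ^ 2 / ν ^ 2)⁻¹ ^ 2 = Real.pi * ν / 4 := by
  rw [integral_Ioi_of_hasDerivAt_of_nonneg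
    (hasDerivAt_lorentz_sq_primitive hν 0).continuousAt.continuousWithinAt
    (fun s _ => hasDerivAt_lorentz_sq_primitive hν s) (fun s _ => by positivity)
    (tendsto_lorentz_sq_primitive hν)]
  simp

lemma norm_rayWeight_mul_exp_le {s ε τ : ℝ} (ν : ℝ) (hs : 0 ≤ s) (hτ : 0 ≤ τ) :
    ‖rayWeight ν τ * Complex.exp (-(s * rayPoint ε τ))‖ ≤
      ‖rayWeight ν τ‖ * Real.exp (-(ε * s)) := by
  rw [norm_mul, norm_exp_neg_mul_rayPoint]
  refine mul_le_mul_of_nonneg_left (Real.exp_le_exp.mpr ?_) (norm_nonneg _)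
  nlinarith [mul_nonneg hs hτ]

lemma continuous_rayWeight_mul_exp (ν s ε : ℝ) :
    Continuous fun τ => rayWeight ν τ * Complex.exp (-(s * rayPoint ε τ)) :=
  (continuous_rayWeight ν).mul
    (Complex.continuous_exp.comp (continuous_const.mul (continuous_rayPoint ε)).neg)

lemma integrableOn_rayWeight_mul_exp {ν s ε : ℝ} (hν : 0 < ν) (hs : 0 ≤ s) :
    IntegrableOn (fun τ => rayWeight ν τ * Complex.exp (-(s * rayPoint ε τ))) (Ioi 0) := by
  refine ((integrableOn_norm_rayWeight hν).mul_const (Real.exp (-(ε * s)))).mono'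
    (continuous_rayWeight_mul_exp ν s ε).aestronglyMeasurable ?_
  filter_upwards [ae_restrict_mem measurableSet_Ioi] with τ hτ
  exact norm_rayWeight_mul_exp_le ν hs (le_of_lt hτ)

/-- The shift `ε > 0` supplies the summable factor `exp(-ε|k|²)` needed for the exchange. Without it
the integrals of the norms decay only like `|k|⁻²`, which is not summable over `ℤ²`. -/
lemma hasSum_integral_rayWeight {ν ε : ℝ} (hν : 0 < ν) (hε : 0 < ε) :
    HasSum (fun k : ℤ × ℤ => ∫ τ in Ioi (0 : ℝ),
        rayWeight ν τ * Complex.exp (-(latticeSq k * rayPoint ε τ)))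
      (∫ τ in Ioi (0 : ℝ), rayWeight ν τ *
        ∑' k : ℤ × ℤ, Complex.exp (-(latticeSq k * rayPoint ε τ))) := by
  have h := hasSum_integral_of_summable_integral_norm
    (μ := volume.restrict (Ioi (0 : ℝ)))
    (F := fun (k : ℤ × ℤ) τ => rayWeight ν τ * Complex.exp (-(latticeSq k * rayPoint ε τ)))
    (fun k => integrableOn_rayWeight_mul_exp hν (latticeSq_nonneg k)) ?_
  · simpa only [tsum_mul_left] using h
  · refine Summable.of_nonneg_of_le (fun k => integral_nonneg fun τ => norm_nonneg _) (fun k => ?_)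
      ((summable_exp_neg_mul_latticeSq hε).mul_left (∫ τ in Ioi (0 : ℝ), ‖rayWeight ν τ‖))
    rw [← integral_mul_const]
    refine setIntegral_mono_on (integrableOn_rayWeight_mul_exp hν (latticeSq_nonneg k)).norm
      ((integrableOn_norm_rayWeight hν).mul_const _) measurableSet_Ioi fun τ hτ => ?_
    exact norm_rayWeight_mul_exp_le ν (latticeSq_nonneg k) (le_of_lt hτ)

lemma re_rayPoint (ε τ : ℝ) : (rayPoint ε τ).re = ε + τ := by simp [rayPoint]

lemma integrable_prod_rayWeight {ν ε : ℝ} (hν : 0 < ν) (hε : 0 < ε) :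
    Integrable (fun p : ℝ × ℝ => rayWeight ν p.2 * Complex.exp (-(p.1 * rayPoint ε p.2)))
      ((volume.restrict (Ioi 0)).prod (volume.restrict (Ioi 0))) := by
  have hexp : IntegrableOn (fun s : ℝ => Real.exp (-(ε * s))) (Ioi 0) := by
    simpa using integrableOn_affine_mul_exp 1 0 hε
  refine (hexp.mul_prod (integrableOn_norm_rayWeight hν)).mono' ?_ ?_
  · refine Continuous.aestronglyMeasurable ?_
    have h1 := continuous_rayWeight ν
    have h2 := continuous_rayPoint ε
    fun_prop
  · rw [Measure.prod_restrict]
    filter_upwards [ae_restrict_mem (measurableSet_Ioi.prod measurableSet_Ioi)] with p hp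
    rw [mul_comm (Real.exp _)]
    exact norm_rayWeight_mul_exp_le ν (le_of_lt hp.1) (le_of_lt hp.2)

/-- The zero Poisson mode is `π / t = π ∫₀^∞ exp(-st) ds`; this exchange converts it back into an
integral of the original function of `s`. -/
lemma integral_integral_rayWeight {ν ε : ℝ} (hν : 0 < ν) (hε : 0 < ε) :
    ∫ s in Ioi (0 : ℝ), ∫ τ in Ioi (0 : ℝ),
        rayWeight ν τ * Complex.exp (-(s * rayPoint ε τ)) =
      ∫ τ in Ioi (0 : ℝ), rayWeight ν τ * (1 / rayPoint ε τ) := by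
  rw [integral_integral_swap]
  · refine setIntegral_congr_fun measurableSet_Ioi fun τ hτ => ?_
    have hτ : 0 < τ := hτ
    have ht : 0 < (rayPoint ε τ).re := by rw [re_rayPoint]; linarith
    have h := integral_affine_mul_cexp 1 0 ht
    simp only [zero_mul, add_zero, one_mul, zero_div] at h
    rw [integral_const_mul, ← h]
    simp_rw [mul_comm (rayPoint ε τ)]
  · exact integrable_prod_rayWeight hν hε

/-- After Poisson inversion the subtracted `π / t` is exactly the mode `k = 0`; the remaining modes
are summed with `latticeMajorant`. -/
lemma norm_tsum_cexp_sub_le {ε τ : ℝ} (hε : 0 < ε) (hτ : 0 ≤ τ) :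
    ‖∑' k : ℤ × ℤ, Complex.exp (-(latticeSq k * rayPoint ε τ)) - Real.pi / rayPoint ε τ‖ ≤
      8 * √2 * Real.exp (-2) / Real.pi ^ 3 * (ε + τ) * (13 * Real.pi ^ 4 / 180) := by
  have ht : 0 < (rayPoint ε τ).re := by rw [re_rayPoint]; linarith
  have ht0 : rayPoint ε τ ≠ 0 := by intro h; rw [h] at ht; simp at ht
  have hinv : 0 < ((Real.pi : ℂ) ^ 2 / rayPoint ε τ).re := by
    have : ((Real.pi : ℂ) ^ 2 / rayPoint ε τ) = ((Real.pi ^ 2 : ℝ) : ℂ) * (rayPoint ε τ)⁻¹ := by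
      push_cast; rfl
    rw [this, Complex.re_ofReal_mul, Complex.inv_re]
    have := Complex.normSq_pos.mpr ht0
    positivity
  have hs := (summable_cexp_neg_mul_latticeSq hinv).mul_left (Real.pi / rayPoint ε τ)
  rw [tsum_cexp_neg_mul_latticeSq_inversion ht, ← tsum_mul_left,
    hs.tsum_eq_add_tsum_ite (0 : ℤ × ℤ)]
  have h0 : latticeSq 0 = 0 := by simp [latticeSq]
  simp only [h0, Complex.ofReal_zero, zero_mul, neg_zero, Complex.exp_zero, mul_one]
  rw [add_sub_cancel_left]
  refine tsum_of_norm_bounded (hasSum_latticeMajorant.mul_left _) fun k => ?_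
  split_ifs with hk
  · rw [norm_zero]
    have := latticeMajorant_nonneg k
    positivity
  · refine (norm_exp_inv_rayPoint_le hε hτ (latticeSq_pos hk)).trans ?_
    gcongr
    exact one_div_latticeSq_sq_le k

lemma integral_pow_mul_exp_neg_mul_Ioi {r : ℝ} (hr : 0 < r) (n : ℕ) :
    ∫ t in Ioi (0 : ℝ), t ^ n * Real.exp (-(r * t)) = n.factorial / r ^ (n + 1) := by
  have h := Real.integral_rpow_mul_exp_neg_mul_Ioi (a := n + 1) (r := r) (by positivity) hr
  rw [Real.Gamma_nat_eq_factorial] at h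
  rw [← setIntegral_congr_fun measurableSet_Ioi
    (f := fun t : ℝ => t ^ ((n : ℝ) + 1 - 1) * Real.exp (-(r * t))), h]
  · rw [one_div, Real.inv_rpow hr.le]
    have : r ^ ((n : ℝ) + 1) = r ^ (n + 1) := by exact_mod_cast Real.rpow_natCast r (n + 1)
    rw [this]; ring
  · intro t _
    simp

lemma integrableOn_pow_mul_exp_neg_mul {r : ℝ} (hr : 0 < r) (n : ℕ) :
    IntegrableOn (fun t : ℝ => t ^ n * Real.exp (-(r * t))) (Ioi 0) := by
  have := integrableOn_rpow_mul_exp_neg_mul_rpow (s := n) (p := 1) (b := r)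
    (by have : (0 : ℝ) ≤ n := n.cast_nonneg
        linarith) one_pos hr
  simpa using this

lemma integrableOn_and_integral_quadratic_mul_exp {r : ℝ} (hr : 0 < r) (a b c : ℝ) :
    IntegrableOn (fun t : ℝ => (a + b * t + c * t ^ 2) * Real.exp (-(r * t))) (Ioi 0) ∧
      ∫ t in Ioi (0 : ℝ), (a + b * t + c * t ^ 2) * Real.exp (-(r * t)) =
        a / r + b / r ^ 2 + 2 * c / r ^ 3 := by
  have i0 := (integrableOn_pow_mul_exp_neg_mul hr 0).const_mul a
  have i1 := (integrableOn_pow_mul_exp_neg_mul hr 1).const_mul b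
  have i2 := (integrableOn_pow_mul_exp_neg_mul hr 2).const_mul c
  have e : (fun t : ℝ => (a + b * t + c * t ^ 2) * Real.exp (-(r * t))) =
      fun t => a * (t ^ 0 * Real.exp (-(r * t))) + b * (t ^ 1 * Real.exp (-(r * t))) +
        c * (t ^ 2 * Real.exp (-(r * t))) := by
    ext t; ring
  have i01 : IntegrableOn (fun t : ℝ => a * (t ^ 0 * Real.exp (-(r * t))) +
      b * (t ^ 1 * Real.exp (-(r * t)))) (Ioi 0) := i0.add i1
  rw [e]
  refine ⟨i01.add i2, ?_⟩
  rw [integral_add i01 i2, integral_add i0 i1, integral_const_mul, integral_const_mul,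
    integral_const_mul, integral_pow_mul_exp_neg_mul_Ioi hr, integral_pow_mul_exp_neg_mul_Ioi hr,
    integral_pow_mul_exp_neg_mul_Ioi hr]
  simp [Nat.factorial]
  ring

/-- The constant in the error term of the regularized lattice sum. -/
noncomputable def thetaErrorConst : ℝ :=
  8 * √2 * Real.exp (-2) / Real.pi ^ 3 * (13 * Real.pi ^ 4 / 180)

lemma thetaErrorConst_pos : 0 < thetaErrorConst := by unfold thetaErrorConst; positivity

lemma thetaErrorConst_le : thetaErrorConst ≤ 7 / 20 := by
  have h1 : √2 ≤ 1.415 := by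
    rw [Real.sqrt_le_left (by norm_num)]; norm_num
  have h2 : Real.exp (-2) ≤ 0.1354 := by
    have h := Real.exp_one_gt_d9
    have : Real.exp (-2) = (Real.exp 1 ^ 2)⁻¹ := by
      rw [← Real.exp_nat_mul, ← Real.exp_neg]; norm_num
    rw [this]
    calc (Real.exp 1 ^ 2)⁻¹ ≤ ((2.7182 : ℝ) ^ 2)⁻¹ := by gcongr; linarith
      _ ≤ 0.1354 := by norm_num
  have h3 : Real.pi ≤ 3.1416 := Real.pi_lt_d4.le
  have e : thetaErrorConst = 8 * √2 * Real.exp (-2) * (13 * Real.pi / 180) := by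
    unfold thetaErrorConst; field_simp
  rw [e]
  calc 8 * √2 * Real.exp (-2) * (13 * Real.pi / 180)
      ≤ 8 * 1.415 * 0.1354 * (13 * 3.1416 / 180) := by gcongr
    _ ≤ 7 / 20 := by norm_num

/-- The regularized lattice sum is its integral up to the theta error. -/
lemma sum_lattice_regularized_le {ν ε : ℝ} (hν : 0 < ν) (hε : 0 < ε) (K : Finset (ℤ × ℤ)) :
    ∑ k ∈ K, Real.exp (-(latticeSq k * ε)) * (1 + latticeSq k ^ 2 / ν ^ 2)⁻¹ ^ 2 ≤
      Real.pi ^ 2 / 4 * ν +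
        thetaErrorConst / 2 * ((√2 + 4) / ν + (√2 + 2) * ε) := by
  set W := rayWeight ν
  set S : ℝ → ℂ := fun τ => ∑' k : ℤ × ℤ, Complex.exp (-(latticeSq k * rayPoint ε τ))
  have hsum := hasSum_integral_rayWeight hν hε
  have hsum' : HasSum
      (fun k : ℤ × ℤ => Real.exp (-(latticeSq k * ε)) * (1 + latticeSq k ^ 2 / ν ^ 2)⁻¹ ^ 2)
      (-(ν ^ 2 / 2) * (∫ τ in Ioi (0 : ℝ), W τ * S τ).re) := by
    refine ((Complex.hasSum_re hsum).mul_left (-(ν ^ 2 / 2))).congr_fun fun k => ?_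
    exact exp_mul_eq_integral_rayWeight hν (latticeSq_nonneg k) ε
  refine (sum_le_hasSum K (fun k _ => by positivity) hsum').trans ?_
  have hE : ∀ τ ∈ Ioi (0 : ℝ), ‖W τ * (S τ - Real.pi / rayPoint ε τ)‖ ≤
      thetaErrorConst * ((√2 / ν * ε + (√2 / ν + 2 * ε) * τ + 2 * τ ^ 2) *
        Real.exp (-(ν * τ))) := by
    intro τ hτ
    have hτ : 0 < τ := hτ
    rw [norm_mul]
    calc ‖W τ‖ * ‖S τ - Real.pi / rayPoint ε τ‖
        ≤ ((√2 / ν + 2 * τ) * Real.exp (-(ν * τ))) *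
          (8 * √2 * Real.exp (-2) / Real.pi ^ 3 * (ε + τ) * (13 * Real.pi ^ 4 / 180)) :=
          mul_le_mul (norm_rayWeight_le hν hτ.le) (norm_tsum_cexp_sub_le hε hτ.le)
            (norm_nonneg _) (by positivity)
      _ = _ := by unfold thetaErrorConst; ring
  obtain ⟨hqi, hqe⟩ := integrableOn_and_integral_quadratic_mul_exp hν (√2 / ν * ε)
    (√2 / ν + 2 * ε) 2
  have hmain_int : IntegrableOn (fun τ => W τ * (Real.pi / rayPoint ε τ)) (Ioi 0) := by
    refine ((integrableOn_norm_rayWeight hν).mul_const (Real.pi / ε)).mono' ?_ ?_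
    · exact ((continuous_rayWeight ν).measurable.mul
        ((measurable_const).div (continuous_rayPoint ε).measurable)).aestronglyMeasurable
    · filter_upwards [ae_restrict_mem measurableSet_Ioi] with τ hτ
      have hτ : 0 < τ := hτ
      rw [norm_mul, norm_div, Complex.norm_real, Real.norm_of_nonneg Real.pi_pos.le]
      have : ε ≤ ‖rayPoint ε τ‖ := by
        refine le_trans ?_ (Complex.re_le_norm _)
        rw [re_rayPoint]; linarith
      gcongr
  have hS_meas : AEStronglyMeasurable S (volume.restrict (Ioi 0)) := by
    have : ∀ k : ℤ × ℤ, Continuous fun τ => Complex.exp (-(latticeSq k * rayPoint ε τ)) := fun k =>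
      Complex.continuous_exp.comp (continuous_const.mul (continuous_rayPoint ε)).neg
    have hcont : ContinuousOn S (Ioi 0) := by
      refine continuousOn_tsum (fun k => (this k).continuousOn)
        (summable_exp_neg_mul_latticeSq hε) fun k τ hτ => ?_
      have hτ : 0 < τ := hτ
      rw [norm_exp_neg_mul_rayPoint]
      refine Real.exp_le_exp.mpr ?_
      nlinarith [mul_nonneg (latticeSq_nonneg k) hτ.le]
    exact hcont.aestronglyMeasurable measurableSet_Ioi
  have herr_int : IntegrableOn (fun τ => W τ * (S τ - Real.pi / rayPoint ε τ)) (Ioi 0) := by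
    refine (hqi.const_mul thetaErrorConst).mono' ?_ ?_
    · exact (continuous_rayWeight ν).aestronglyMeasurable.mul (hS_meas.sub
        ((measurable_const).div (continuous_rayPoint ε).measurable).aestronglyMeasurable)
    · filter_upwards [ae_restrict_mem measurableSet_Ioi] with τ hτ using hE τ hτ
  have hsplit : ∫ τ in Ioi (0 : ℝ), W τ * S τ =
      (∫ τ in Ioi (0 : ℝ), W τ * (Real.pi / rayPoint ε τ)) +
        ∫ τ in Ioi (0 : ℝ), W τ * (S τ - Real.pi / rayPoint ε τ) := by
    rw [← integral_add hmain_int herr_int]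
    congr 1
    ext τ
    ring
  have herr : ‖∫ τ in Ioi (0 : ℝ), W τ * (S τ - Real.pi / rayPoint ε τ)‖ ≤
      thetaErrorConst * (√2 / ν * ε / ν + (√2 / ν + 2 * ε) / ν ^ 2 + 2 * 2 / ν ^ 3) := by
    rw [← hqe, ← integral_const_mul]
    refine norm_integral_le_of_norm_le (hqi.const_mul _) ?_
    filter_upwards [ae_restrict_mem measurableSet_Ioi] with τ hτ using hE τ hτ
  -- Reading the Laplace representation backwards, the main term is `π ∫₀^∞ exp(-sε) (1 + s²/ν²)⁻²
  -- ds`, and dropping the exponential costs nothing.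
  have hmain : -(ν ^ 2 / 2) * (∫ τ in Ioi (0 : ℝ), W τ * (Real.pi / rayPoint ε τ)).re ≤
      Real.pi ^ 2 / 4 * ν := by
    have e1 : ∫ τ in Ioi (0 : ℝ), W τ * (Real.pi / rayPoint ε τ) =
        Real.pi * ∫ τ in Ioi (0 : ℝ), W τ * (1 / rayPoint ε τ) := by
      rw [← integral_const_mul]
      congr 1
      ext τ
      ring
    have hint : IntegrableOn (fun s : ℝ => ∫ τ in Ioi (0 : ℝ),
        W τ * Complex.exp (-(s * rayPoint ε τ))) (Ioi 0) := by
      exact (integrable_prod_rayWeight hν hε).integral_prod_left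
    have e2 : -(ν ^ 2 / 2) * (∫ τ in Ioi (0 : ℝ), W τ * (1 / rayPoint ε τ)).re =
        ∫ s in Ioi (0 : ℝ), Real.exp (-(s * ε)) * (1 + s ^ 2 / ν ^ 2)⁻¹ ^ 2 := by
      rw [← integral_integral_rayWeight hν hε]
      have hre := integral_re hint
      simp only [RCLike.re_eq_complex_re] at hre
      rw [← hre, ← integral_const_mul]
      refine setIntegral_congr_fun measurableSet_Ioi fun s hs => ?_
      exact (exp_mul_eq_integral_rayWeight hν (le_of_lt hs) ε).symm
    have e3 : ∫ s in Ioi (0 : ℝ), Real.exp (-(s * ε)) * (1 + s ^ 2 / ν ^ 2)⁻¹ ^ 2 ≤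
        Real.pi * ν / 4 := by
      rw [← integral_lorentz_sq hν]
      refine integral_mono_of_nonneg (.of_forall fun s => by positivity)
        (integrableOn_lorentz_sq hν) ?_
      filter_upwards [ae_restrict_mem measurableSet_Ioi] with s hs
      have hs : 0 < s := hs
      refine mul_le_of_le_one_left (by positivity) (Real.exp_le_one_iff.mpr ?_)
      have := mul_pos hs hε
      linarith
    rw [e1, Complex.re_ofReal_mul]
    calc _ = Real.pi * (-(ν ^ 2 / 2) * (∫ τ in Ioi (0 : ℝ), W τ * (1 / rayPoint ε τ)).re) := by
          ring
      _ ≤ Real.pi * (Real.pi * ν / 4) := by rw [e2]; gcongr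
      _ = _ := by ring
  rw [hsplit, Complex.add_re, mul_add]
  refine add_le_add hmain ?_
  have hre := (abs_le.mp ((Complex.abs_re_le_norm _).trans herr)).1
  calc _ = (ν ^ 2 / 2) * -(∫ τ in Ioi (0 : ℝ), W τ * (S τ - Real.pi / rayPoint ε τ)).re := by ring
    _ ≤ (ν ^ 2 / 2) * (thetaErrorConst *
          (√2 / ν * ε / ν + (√2 / ν + 2 * ε) / ν ^ 2 + 2 * 2 / ν ^ 3)) := by
        gcongr; linarith
    _ = _ := by field_simp; ring

/-- The lattice sum estimate for large `ν`. -/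
lemma sum_lattice_le_of_ge {ν : ℝ} (hν : 13 / 10 ≤ ν) (K : Finset (ℤ × ℤ)) (hK : 0 ∉ K) :
    ∑ k ∈ K, (1 + latticeSq k ^ 2 / ν ^ 2)⁻¹ ^ 2 ≤ Real.pi ^ 2 / 4 * ν := by
  have hν0 : 0 < ν := by linarith
  -- The regularized estimate holds with the origin included. Its term equals `1`, and removing it
  -- at the end pays for the theta error.
  have hlim : Filter.Tendsto (fun ε : ℝ => ∑ k ∈ insert 0 K,
      Real.exp (-(latticeSq k * ε)) * (1 + latticeSq k ^ 2 / ν ^ 2)⁻¹ ^ 2)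
      (nhdsWithin 0 (Ioi 0))
      (nhds (∑ k ∈ insert 0 K, (1 + latticeSq k ^ 2 / ν ^ 2)⁻¹ ^ 2)) := by
    have : Continuous (fun ε : ℝ => ∑ k ∈ insert 0 K,
      Real.exp (-(latticeSq k * ε)) * (1 + latticeSq k ^ 2 / ν ^ 2)⁻¹ ^ 2) := by fun_prop
    have h := this.tendsto 0
    simp only [mul_zero, neg_zero, Real.exp_zero, one_mul] at h
    exact h.mono_left nhdsWithin_le_nhds
  have hlim2 : Filter.Tendsto (fun ε : ℝ => Real.pi ^ 2 / 4 * ν +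
        thetaErrorConst / 2 * ((√2 + 4) / ν + (√2 + 2) * ε)) (nhdsWithin 0 (Ioi 0))
      (nhds (Real.pi ^ 2 / 4 * ν + thetaErrorConst / 2 * ((√2 + 4) / ν + (√2 + 2) * 0))) := by
    have : Continuous (fun ε : ℝ => Real.pi ^ 2 / 4 * ν +
        thetaErrorConst / 2 * ((√2 + 4) / ν + (√2 + 2) * ε)) := by fun_prop
    exact (this.tendsto 0).mono_left nhdsWithin_le_nhds
  have h := le_of_tendsto_of_tendsto hlim hlim2 (by
    filter_upwards [self_mem_nhdsWithin] with ε hε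
    exact sum_lattice_regularized_le hν0 hε _)
  rw [Finset.sum_insert hK] at h
  have h0 : latticeSq 0 = 0 := by simp [latticeSq]
  rw [h0] at h
  have hc : thetaErrorConst / 2 * ((√2 + 4) / ν + (√2 + 2) * 0) ≤ 1 := by
    have h1 : √2 ≤ 1.415 := by
      rw [Real.sqrt_le_left (by norm_num)]; norm_num
    have hp := thetaErrorConst_pos
    calc thetaErrorConst / 2 * ((√2 + 4) / ν + (√2 + 2) * 0)
        ≤ 7 / 20 / 2 * ((1.415 + 4) / (13 / 10)) := by
          rw [mul_zero, add_zero]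
          gcongr
          exact thetaErrorConst_le
      _ ≤ 1 := by norm_num
  norm_num at h hc ⊢
  linarith

/-- `∑_{k ≠ 0} (1 + |k|⁴ / ν²)⁻² ≤ (π² / 4) ν` over the integer lattice. -/
lemma sum_lattice_le {ν : ℝ} (hν : 0 < ν) (K : Finset (ℤ × ℤ)) (hK : 0 ∉ K) :
    ∑ k ∈ K, (1 + latticeSq k ^ 2 / ν ^ 2)⁻¹ ^ 2 ≤ Real.pi ^ 2 / 4 * ν := by
  -- The first estimate works up to `180 / (13π²) ≈ 1.40`, the second from about `0.95` on; `13/10`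
  -- lies in the overlap.
  rcases le_total ν (13 / 10) with h | h
  · exact sum_lattice_le_of_le hν h K hK
  · exact sum_lattice_le_of_ge h K hK

/-! ### Eigenvalue sums and the integrals over the cut-off level. -/

/-- The eigenvalues of `-Δ` on the elongated torus. -/
noncomputable def eigenvalue (α : ℝ) (k : ℤ × ℤ) : ℝ := (α * k.1) ^ 2 + (k.2 : ℝ) ^ 2

/-- As `α ≤ 1`, each eigenvalue is at least `α²|k|²`, so the square lattice bound applies at level
`ν/α²`. -/
lemma sum_eigenvalue_le {α : ℝ} (hα₀ : 0 < α) (hα₁ : α ≤ 1) {ν : ℝ} (hν : 0 < ν)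
    (K : Finset (ℤ × ℤ)) (hK : 0 ∉ K) :
    ∑ k ∈ K, (1 + eigenvalue α k ^ 2 / ν ^ 2)⁻¹ ^ 2 ≤ Real.pi ^ 2 / (4 * α ^ 2) * ν := by
  have h := sum_lattice_le (ν := ν / α ^ 2) (by positivity) K hK
  have e : Real.pi ^ 2 / 4 * (ν / α ^ 2) = Real.pi ^ 2 / (4 * α ^ 2) * ν := by
    field_simp
  rw [← e]
  refine (Finset.sum_le_sum fun k _ => ?_).trans h
  have hle : α ^ 2 * latticeSq k ≤ eigenvalue α k := by
    unfold latticeSq eigenvalue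
    have : α ^ 2 ≤ 1 := pow_le_one₀ hα₀.le hα₁
    nlinarith [sq_nonneg (k.2 : ℝ)]
  have h0 := latticeSq_nonneg k
  have e2 : latticeSq k ^ 2 / (ν / α ^ 2) ^ 2 = (α ^ 2 * latticeSq k) ^ 2 / ν ^ 2 := by
    field_simp
  rw [e2]
  gcongr

/-- The integrand is `(√r - √(Aν))²` expanded, and `r/A` is the point where it vanishes. -/
lemma integral_sqrt_sub_sq {r A : ℝ} (hr : 0 ≤ r) (hA : 0 < A) :
    ∫ ν in (0 : ℝ)..(r / A), (r - 2 * (√r * √A) * √ν + A * ν) = r ^ 2 / (6 * A) := by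
  have hsqrt : ∫ ν in (0 : ℝ)..(r / A), √ν = 2 / 3 * (r / A * √(r / A)) := by
    simp_rw [Real.sqrt_eq_rpow]
    rw [integral_rpow (Or.inl (by norm_num))]
    have hR : 0 ≤ r / A := by positivity
    have e : (r / A) ^ ((1 : ℝ) / 2 + 1) = r / A * (r / A) ^ ((1 : ℝ) / 2) := by
      rw [Real.rpow_add_one' hR (by norm_num), mul_comm]
    rw [e, Real.zero_rpow (by norm_num)]
    ring
  have i1 : IntervalIntegrable (fun ν : ℝ => r - 2 * (√r * √A) * √ν) volume 0 (r / A) :=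
    Continuous.intervalIntegrable (by fun_prop) _ _
  have i2 : IntervalIntegrable (fun ν : ℝ => 2 * (√r * √A) * √ν) volume 0 (r / A) :=
    Continuous.intervalIntegrable (by fun_prop) _ _
  have i3 : IntervalIntegrable (fun ν : ℝ => A * ν) volume 0 (r / A) :=
    Continuous.intervalIntegrable (by fun_prop) _ _
  rw [intervalIntegral.integral_add i1 i3,
    intervalIntegral.integral_sub intervalIntegrable_const i2,
    intervalIntegral.integral_const_mul, intervalIntegral.integral_const_mul, hsqrt, integral_id,
    intervalIntegral.integral_const, Real.sqrt_div hr]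
  have hA' : 0 < √A := Real.sqrt_pos.mpr hA
  have hr2 : √r * √r = r := Real.mul_self_sqrt hr
  have : 2 * (√r * √A) * (2 / 3 * (r / A * (√r / √A))) = 4 / 3 * r ^ 2 / A := by
    field_simp
    linear_combination (4 * r) * hr2
  rw [this]
  simp only [smul_eq_mul]
  field_simp
  ring

/-- `∫₀^∞ (√r - √(A ν))₊² dν = r² / (6 A)`. -/
lemma ofReal_le_lintegral_sqrt_sub_sq {r A : ℝ} (hr : 0 ≤ r) (hA : 0 < A) :
    ENNReal.ofReal (r ^ 2 / (6 * A)) ≤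
      ∫⁻ ν in Ioi (0 : ℝ), ENNReal.ofReal (max 0 (√r - √(A * ν)) ^ 2) := by
  have hR : 0 ≤ r / A := by positivity
  have hint : IntegrableOn (fun ν : ℝ => max 0 (√r - √(A * ν)) ^ 2) (Ioc 0 (r / A)) := by
    refine Continuous.integrableOn_Ioc ?_
    fun_prop
  rw [← integral_sqrt_sub_sq hr hA, intervalIntegral.integral_of_le hR]
  have heq : ∫ ν in Ioc 0 (r / A), (r - 2 * (√r * √A) * √ν + A * ν) =
      ∫ ν in Ioc 0 (r / A), max 0 (√r - √(A * ν)) ^ 2 := by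
    refine setIntegral_congr_fun measurableSet_Ioc fun ν hν => ?_
    have hle : √(A * ν) ≤ √r := by
      refine Real.sqrt_le_sqrt ?_
      have := (le_div_iff₀ hA).mp hν.2
      linarith
    rw [max_eq_right (sub_nonneg.mpr hle), sub_sq, Real.sq_sqrt hr,
      Real.sq_sqrt (mul_nonneg hA.le hν.1.le), Real.sqrt_mul hA.le]
    ring
  rw [heq, ofReal_integral_eq_lintegral_ofReal hint (.of_forall fun ν => by positivity)]
  -- Beyond `r/A` the positive part is zero, so nothing is lost; only this inequality is needed.
  exact lintegral_mono_set Ioc_subset_Ioi_self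

/-- Since `1 - (1 + l²/ν²)⁻¹ = (1 + ν²/l²)⁻¹`, the high energy weight is the low energy one with `l`
and `ν` exchanged. -/
lemma lintegral_lorentz_sq {l : ℝ} (hl : 0 < l) :
    ∫⁻ ν in Ioi (0 : ℝ), ENNReal.ofReal ((1 - (1 + l ^ 2 / ν ^ 2)⁻¹) ^ 2) =
      ENNReal.ofReal (Real.pi * l / 4) := by
  rw [← integral_lorentz_sq hl, ofReal_integral_eq_lintegral_ofReal (integrableOn_lorentz_sq hl)
    (.of_forall fun ν => by positivity)]
  refine setLIntegral_congr_fun measurableSet_Ioi fun ν hν => ?_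
  have hν : 0 < ν := hν
  congr 2
  field_simp
  ring

/-! ### The cut-off argument for an abstract Hilbert basis. -/

section Abstract

variable {Ω ι : Type*} [MeasurableSpace Ω] {μ : Measure Ω}

lemma tsum_enorm_inner_sq (b : HilbertBasis ι ℂ (Lp ℂ 2 μ)) (f : Lp ℂ 2 μ) :
    ∑' k, ‖inner ℂ (b k) f‖ₑ ^ 2 = ‖f‖ₑ ^ 2 := by
  have h := b.hasSum_inner_mul_inner f f
  have h2 : HasSum (fun k => ‖inner ℂ (b k) f‖ ^ 2) (‖f‖ ^ 2) := by
    have h3 := Complex.hasSum_re h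
    rw [inner_self_eq_norm_sq_to_K] at h3
    convert! h3 using 1
    · ext k
      rw [← inner_conj_symm f (b k), mul_comm, RCLike.mul_conj]
      norm_cast
    · norm_cast
  have e : ∀ z : ℂ, ‖z‖ₑ ^ 2 = ENNReal.ofReal (‖z‖ ^ 2) := fun z => by
    rw [ENNReal.ofReal_pow (norm_nonneg _), ofReal_norm]
  simp_rw [e]
  rw [← ENNReal.ofReal_tsum_of_nonneg (fun _ => by positivity) h2.summable, h2.tsum_eq,
    ENNReal.ofReal_pow (norm_nonneg _), ofReal_norm]

lemma lintegral_enorm_sq (f : Lp ℂ 2 μ) : ∫⁻ x, ‖f x‖ₑ ^ 2 ∂μ = ‖f‖ₑ ^ 2 := by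
  rw [Lp.enorm_def, eLpNorm_eq_lintegral_rpow_enorm_toReal (by norm_num) (by norm_num)]
  simp only [ENNReal.toReal_ofNat, ENNReal.rpow_ofNat]
  rw [← ENNReal.rpow_natCast, ← ENNReal.rpow_mul]
  norm_num

/-- The smoothed low energy part of `f`, localized to finitely many modes. -/
noncomputable def lowEnergyPart (b : HilbertBasis ι ℂ (Lp ℂ 2 μ)) (m : ι → ℝ) (K : Finset ι)
    (f : Lp ℂ 2 μ) : Lp ℂ 2 μ :=
  ∑ k ∈ K, ((m k : ℂ) * inner ℂ (b k) f) • b k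

lemma coeFn_lowEnergyPart (b : HilbertBasis ι ℂ (Lp ℂ 2 μ)) (m : ι → ℝ) (K : Finset ι)
    (f : Lp ℂ 2 μ) :
    ∀ᵐ x ∂μ, lowEnergyPart b m K f x = ∑ k ∈ K, ((m k : ℂ) * inner ℂ (b k) f) * b k x := by
  have h1 := Lp.coeFn_fun_finsetSum K fun k => ((m k : ℂ) * inner ℂ (b k) f) • b k
  have h2 : ∀ᵐ x ∂μ, ∀ k ∈ K, (((m k : ℂ) * inner ℂ (b k) f) • b k : Lp ℂ 2 μ) x =
      ((m k : ℂ) * inner ℂ (b k) f) * b k x := by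
    rw [Finset.eventually_all]
    intro k _
    filter_upwards [Lp.coeFn_smul ((m k : ℂ) * inner ℂ (b k) f) (b k)] with x hx
    rw [hx]; rfl
  filter_upwards [h1, h2] with x hx1 hx2
  rw [lowEnergyPart, hx1]
  exact Finset.sum_congr rfl hx2

open Classical in
lemma inner_sub_lowEnergyPart (b : HilbertBasis ι ℂ (Lp ℂ 2 μ)) (m : ι → ℝ) (K : Finset ι)
    (f : Lp ℂ 2 μ) (k : ι) :
    inner ℂ (b k) (f - lowEnergyPart b m K f) =
      ((1 - if k ∈ K then m k else 0 : ℝ) : ℂ) * inner ℂ (b k) f := by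
  rw [inner_sub_right, lowEnergyPart]
  by_cases hk : k ∈ K
  · rw [b.orthonormal.inner_right_sum _ hk]
    simp [hk]; ring
  · rw [inner_sum, Finset.sum_eq_zero]
    · simp [hk]
    · intro i hi
      rw [inner_smul_right, b.orthonormal.inner_eq_zero (by rintro rfl; exact hk hi), mul_zero]

/-- Pointwise Bessel inequality for the low energy parts of an orthonormal family. -/
lemma sum_norm_lowEnergyPart_sq_le (b : HilbertBasis ι ℂ (Lp ℂ 2 μ)) {c : ℝ}
    (hb : ∀ k, ∀ᵐ x ∂μ, ‖b k x‖ ^ 2 ≤ c) (m : ι → ℝ) (K : Finset ι) {N : ℕ}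
    {P : Fin N → Lp ℂ 2 μ} (hP : Orthonormal ℂ P) :
    ∀ᵐ x ∂μ, ∑ j, ‖lowEnergyPart b m K (P j) x‖ ^ 2 ≤ c * ∑ k ∈ K, m k ^ 2 := by
  have hb' : ∀ᵐ x ∂μ, ∀ k ∈ K, ‖b k x‖ ^ 2 ≤ c := by
    rw [Finset.eventually_all]
    exact fun k _ => hb k
  have hχ : ∀ᵐ x ∂μ, ∀ j, lowEnergyPart b m K (P j) x =
      ∑ k ∈ K, ((m k : ℂ) * inner ℂ (b k) (P j)) * b k x :=
    ae_all_iff.mpr fun j => coeFn_lowEnergyPart b m K (P j)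
  filter_upwards [hb', hχ] with x hx hχx
  -- With `x` frozen, `G` is the kernel of the multiplier at `x`: pairing it with `P j` evaluates
  -- the low energy part at `x`, so Bessel's inequality for `P` applies to `G`.
  set G : Lp ℂ 2 μ := ∑ k ∈ K, ((m k : ℂ) * conj (b k x)) • b k
  have hG : ∀ j, ‖lowEnergyPart b m K (P j) x‖ = ‖inner ℂ (P j) G‖ := by
    intro j
    rw [hχx j, norm_inner_symm, sum_inner]
    congr 1
    refine Finset.sum_congr rfl fun k _ => ?_
    rw [inner_smul_left]
    simp
    ring
  simp_rw [hG]
  refine (hP.sum_inner_products_le G).trans ?_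
  have hn : ‖G‖ ^ 2 = ∑ k ∈ K, ‖(m k : ℂ) * conj (b k x)‖ ^ 2 := by
    have h := b.orthonormal.inner_sum (fun k => (m k : ℂ) * conj (b k x))
      (fun k => (m k : ℂ) * conj (b k x)) K
    rw [inner_self_eq_norm_sq_to_K] at h
    have e : ∀ z : ℂ, conj z * z = ((‖z‖ ^ 2 : ℝ) : ℂ) := fun z => by
      rw [RCLike.conj_mul]; norm_cast
    simp_rw [e] at h
    refine Complex.ofReal_injective ?_
    push_cast at h ⊢
    exact h
  rw [hn, Finset.mul_sum]
  refine Finset.sum_le_sum fun k hk => ?_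
  rw [norm_mul, mul_pow, RCLike.norm_conj, Complex.norm_real, Real.norm_eq_abs, sq_abs, mul_comm]
  exact mul_le_mul_of_nonneg_right (hx k hk) (sq_nonneg _)

/-- The triangle inequality for `ℓ²` sums, in the form of a lower bound. -/
lemma max_sqrt_sub_sq_le {N : ℕ} (u v : Fin N → ℂ) {B : ℝ} (hv : ∑ j, ‖v j‖ ^ 2 ≤ B) :
    max 0 (√(∑ j, ‖u j‖ ^ 2) - √B) ^ 2 ≤ ∑ j, ‖u j - v j‖ ^ 2 := by
  have h := norm_sub_norm_le (WithLp.toLp 2 u : EuclideanSpace ℂ (Fin N)) (WithLp.toLp 2 v)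
  rw [EuclideanSpace.norm_eq, EuclideanSpace.norm_eq, EuclideanSpace.norm_eq] at h
  simp only [PiLp.sub_apply] at h
  have hB := Real.sqrt_le_sqrt hv
  have hD : 0 ≤ ∑ j, ‖u j - v j‖ ^ 2 := Finset.sum_nonneg fun _ _ => by positivity
  rw [← Real.sq_sqrt hD]
  gcongr
  exact max_le (Real.sqrt_nonneg _) (by linarith)

end Abstract

section Abstract

variable {Ω ι : Type*} [MeasurableSpace Ω] {μ : Measure Ω}

open Classical in
/-- The high energy parts control the excess of the density over the low energy bound. -/
lemma lintegral_max_sqrt_sub_sq_le_finite (b : HilbertBasis ι ℂ (Lp ℂ 2 μ)) {c : ℝ}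
    (hb : ∀ k, ∀ᵐ x ∂μ, ‖b k x‖ ^ 2 ≤ c) (m : ι → ℝ) (K : Finset ι) {B : ℝ}
    (hB : c * ∑ k ∈ K, m k ^ 2 ≤ B) {N : ℕ} {P : Fin N → Lp ℂ 2 μ} (hP : Orthonormal ℂ P) :
    ∫⁻ x, ENNReal.ofReal (max 0 (√(∑ j, ‖P j x‖ ^ 2) - √B) ^ 2) ∂μ ≤
      ∑ j, ∑' k, ENNReal.ofReal ((1 - if k ∈ K then m k else 0) ^ 2) *
        ‖inner ℂ (b k) (P j)‖ₑ ^ 2 := by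
  have hsub : ∀ᵐ x ∂μ, ∀ j, (P j - lowEnergyPart b m K (P j) : Lp ℂ 2 μ) x =
      P j x - lowEnergyPart b m K (P j) x :=
    ae_all_iff.mpr fun j => Lp.coeFn_sub _ _
  calc _ ≤ ∫⁻ x, ∑ j, ‖(P j - lowEnergyPart b m K (P j) : Lp ℂ 2 μ) x‖ₑ ^ 2 ∂μ := by
        refine lintegral_mono_ae ?_
        filter_upwards [hsub, sum_norm_lowEnergyPart_sq_le b hb m K hP] with x hx hx2
        refine (ENNReal.ofReal_le_ofReal (max_sqrt_sub_sq_le (fun j => P j x)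
          (fun j => lowEnergyPart b m K (P j) x) (hx2.trans hB))).trans_eq ?_
        rw [ENNReal.ofReal_sum_of_nonneg fun _ _ => by positivity]
        refine Finset.sum_congr rfl fun j _ => ?_
        rw [hx j, ENNReal.ofReal_pow (norm_nonneg _), ofReal_norm]
    _ = ∑ j, ∫⁻ x, ‖(P j - lowEnergyPart b m K (P j) : Lp ℂ 2 μ) x‖ₑ ^ 2 ∂μ :=
        lintegral_finsetSum' _ fun j _ =>
          ((Lp.aestronglyMeasurable _).enorm).pow_const 2
    _ = _ := by
        refine Finset.sum_congr rfl fun j _ => ?_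
        rw [lintegral_enorm_sq, ← tsum_enorm_inner_sq b]
        refine tsum_congr fun k => ?_
        rw [inner_sub_lowEnergyPart, enorm_mul, mul_pow]
        congr 1
        rw [← ofReal_norm, ← ENNReal.ofReal_pow (norm_nonneg _), Complex.norm_real,
          Real.norm_eq_abs, sq_abs]

/-- The finite version is used on `K` without `k₀`, which is harmless because the `k₀` coefficients
vanish. Modes outside `K` carry weight `1`, and their total is a tail of a convergent Parseval
series, which tends to `0` as `K` grows. -/
lemma lintegral_max_sqrt_sub_sq_le (b : HilbertBasis ι ℂ (Lp ℂ 2 μ)) {c : ℝ}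
    (hb : ∀ k, ∀ᵐ x ∂μ, ‖b k x‖ ^ 2 ≤ c) (m : ι → ℝ) (k₀ : ι) {B : ℝ}
    (hB : ∀ K : Finset ι, k₀ ∉ K → c * ∑ k ∈ K, m k ^ 2 ≤ B) {N : ℕ} {P : Fin N → Lp ℂ 2 μ}
    (hP : Orthonormal ℂ P) (h0 : ∀ j, inner ℂ (b k₀) (P j) = 0) :
    ∫⁻ x, ENNReal.ofReal (max 0 (√(∑ j, ‖P j x‖ ^ 2) - √B) ^ 2) ∂μ ≤
      ∑ j, ∑' k, ENNReal.ofReal ((1 - m k) ^ 2) * ‖inner ℂ (b k) (P j)‖ₑ ^ 2 := by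
  classical
  set a : Fin N → ι → ℝ≥0∞ := fun j k => ‖inner ℂ (b k) (P j)‖ₑ ^ 2
  have hfin : ∀ j, ∑' k, a j k ≠ ⊤ := fun j => by
    rw [tsum_enorm_inner_sq b]
    simp
  have hlim : Filter.Tendsto (fun K : Finset ι => ∑ j,
      ((∑' k, ENNReal.ofReal ((1 - m k) ^ 2) * a j k) + ∑' k : { x // x ∉ K }, a j k))
      Filter.atTop (nhds (∑ j, ((∑' k, ENNReal.ofReal ((1 - m k) ^ 2) * a j k) + 0))) :=
    tendsto_finsetSum _ fun j _ =>
      tendsto_const_nhds.add (ENNReal.tendsto_tsum_compl_atTop_zero (hfin j))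
  simp only [add_zero] at hlim
  refine ge_of_tendsto' hlim fun K => ?_
  refine (lintegral_max_sqrt_sub_sq_le_finite b hb m (K.erase k₀)
    (hB _ (Finset.notMem_erase _ _)) hP).trans (Finset.sum_le_sum fun j _ => ?_)
  have hcompl : ∑' k : { x // x ∉ K }, a j k = ∑' k, if k ∈ K then 0 else a j k := by
    have := tsum_subtype {x | x ∉ K} (a j)
    refine this.trans (tsum_congr fun k => ?_)
    by_cases hk : k ∈ K <;> simp [hk]
  rw [hcompl, ← ENNReal.tsum_add]
  refine ENNReal.tsum_le_tsum fun k => ?_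
  by_cases hk0 : k = k₀
  · have : a j k = 0 := by simp [a, hk0, h0 j]
    change _ * a j k ≤ _
    simp [this]
  · by_cases hk : k ∈ K
    · simp [hk, hk0, a]
    · simp [hk, a]

/-- The Lieb-Thirring inequality for an operator with a Hilbert basis of eigenfunctions `b k`
bounded by `√c`, with eigenvalues `l k` satisfying a smoothed Weyl bound. -/
theorem lintegral_density_sq_le [SFinite μ] [Countable ι] (b : HilbertBasis ι ℂ (Lp ℂ 2 μ)) {c : ℝ}
    (hb : ∀ k, ∀ᵐ x ∂μ, ‖b k x‖ ^ 2 ≤ c) (l : ι → ℝ) (k₀ : ι) (hl : ∀ k, k ≠ k₀ → 0 < l k) {A : ℝ}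
    (hA : 0 < A)
    (hsum : ∀ ν : ℝ, 0 < ν → ∀ K : Finset ι, k₀ ∉ K →
      c * ∑ k ∈ K, (1 + l k ^ 2 / ν ^ 2)⁻¹ ^ 2 ≤ A * ν)
    {N : ℕ} {P : Fin N → Lp ℂ 2 μ} (hP : Orthonormal ℂ P)
    (h0 : ∀ j, inner ℂ (b k₀) (P j) = 0) :
    ∫⁻ x, (∑ j, ‖P j x‖ₑ ^ 2) ^ 2 ∂μ ≤
      ENNReal.ofReal (6 * A * (Real.pi / 4)) *
        ∑ j, ∑' k, ENNReal.ofReal (l k) * ‖inner ℂ (b k) (P j)‖ₑ ^ 2 := by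
  set ρ : Ω → ℝ := fun x => ∑ j, ‖P j x‖ ^ 2
  have hρ0 : ∀ x, 0 ≤ ρ x := fun x => Finset.sum_nonneg fun _ _ => by positivity
  have hρm : Measurable ρ :=
    Finset.measurable_sum _ fun j _ => ((Lp.stronglyMeasurable (P j)).measurable.norm.pow_const 2)
  have hdens : ∀ x, (∑ j, ‖P j x‖ₑ ^ 2) ^ 2 =
      ENNReal.ofReal (6 * A) * ENNReal.ofReal (ρ x ^ 2 / (6 * A)) := by
    intro x
    rw [← ENNReal.ofReal_mul (by positivity), mul_div_cancel₀ _ (by positivity),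
      ENNReal.ofReal_pow (hρ0 x), ENNReal.ofReal_sum_of_nonneg fun _ _ => by positivity]
    congr 1
    refine Finset.sum_congr rfl fun j _ => ?_
    rw [ENNReal.ofReal_pow (norm_nonneg _), ofReal_norm]
  have hF : Measurable (Function.uncurry fun (x : Ω) (ν : ℝ) =>
      ENNReal.ofReal (max 0 (√(ρ x) - √(A * ν)) ^ 2)) := by
    unfold Function.uncurry
    fun_prop
  calc ∫⁻ x, (∑ j, ‖P j x‖ₑ ^ 2) ^ 2 ∂μ
      = ENNReal.ofReal (6 * A) * ∫⁻ x, ENNReal.ofReal (ρ x ^ 2 / (6 * A)) ∂μ := by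
        simp_rw [hdens]
        rw [lintegral_const_mul _ (by fun_prop)]
    _ ≤ ENNReal.ofReal (6 * A) * ∫⁻ x, (∫⁻ ν in Ioi (0 : ℝ),
          ENNReal.ofReal (max 0 (√(ρ x) - √(A * ν)) ^ 2)) ∂μ := by
        gcongr with x
        exact ofReal_le_lintegral_sqrt_sub_sq (hρ0 x) hA
    _ = ENNReal.ofReal (6 * A) * ∫⁻ ν in Ioi (0 : ℝ), (∫⁻ x,
          ENNReal.ofReal (max 0 (√(ρ x) - √(A * ν)) ^ 2) ∂μ) := by
        rw [lintegral_lintegral_swap hF.aemeasurable]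
    _ ≤ ENNReal.ofReal (6 * A) * ∫⁻ ν in Ioi (0 : ℝ), ∑ j, ∑' k,
          ENNReal.ofReal ((1 - (1 + l k ^ 2 / ν ^ 2)⁻¹) ^ 2) *
            ‖inner ℂ (b k) (P j)‖ₑ ^ 2 := by
        refine mul_le_mul_right (setLIntegral_mono' measurableSet_Ioi fun ν hν => ?_) _
        exact lintegral_max_sqrt_sub_sq_le b hb _ k₀ (hsum ν hν) hP h0
    _ = ENNReal.ofReal (6 * A) * ∑ j, ∑' k, ENNReal.ofReal (Real.pi / 4) *
          (ENNReal.ofReal (l k) * ‖inner ℂ (b k) (P j)‖ₑ ^ 2) := by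
        congr 1
        rw [lintegral_finsetSum' _ fun j _ => by fun_prop]
        refine Finset.sum_congr rfl fun j _ => ?_
        rw [lintegral_tsum fun k => by fun_prop]
        refine tsum_congr fun k => ?_
        rw [lintegral_mul_const _ (by fun_prop)]
        -- The sign of `l k₀` is unknown, but the corresponding coefficient is zero.
        by_cases hk : k = k₀
        · simp [hk, h0 j]
        · rw [lintegral_lorentz_sq (hl k hk), ← mul_assoc,
            ← ENNReal.ofReal_mul (by positivity)]
          congr 2
          ring
    _ = _ := by
        simp_rw [ENNReal.tsum_mul_left, ← Finset.mul_sum]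
        rw [← mul_assoc, ← ENNReal.ofReal_mul (by positivity)]

end Abstract

/-! ### The Hilbert basis of exponentials, transported from the unit torus. -/

/-- Haar probability measure on the two-dimensional unit torus. -/
noncomputable def unitTorusMeasure : Measure (Fin 2 → UnitAddCircle) :=
  Measure.pi fun _ => AddCircle.haarAddCircle

instance : IsProbabilityMeasure unitTorusMeasure := by
  unfold unitTorusMeasure; infer_instance

lemma haarAddCircle_eq_volume : (AddCircle.haarAddCircle : Measure UnitAddCircle) = volume := by
  rw [AddCircle.volume_eq_smul_haarAddCircle]
  simp

/-- The representative in `(0, 1]` of a point of the unit circle. -/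
noncomputable def unitRep (t : UnitAddCircle) : ℝ := (AddCircle.equivIoc 1 0 t : ℝ)

lemma coe_unitRep (t : UnitAddCircle) : ((unitRep t : ℝ) : UnitAddCircle) = t :=
  AddCircle.coe_equivIoc

lemma measurePreserving_unitRep :
    MeasurePreserving unitRep AddCircle.haarAddCircle (volume.restrict (Ioc 0 1)) := by
  have h1 := AddCircle.measurePreserving_equivIoc 1 (a := 0)
  have h2 := measurePreserving_subtype_coe (μa := (volume : Measure ℝ))
    (measurableSet_Ioc (a := (0 : ℝ)) (b := 0 + 1))
  rw [haarAddCircle_eq_volume]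
  have h : MeasurePreserving unitRep volume (volume.restrict (Ioc 0 (0 + 1))) := h2.comp h1
  rwa [zero_add] at h

lemma map_mul_left_restrict_Ioc {a : ℝ} (ha : 0 < a) :
    Measure.map (a * ·) (volume.restrict (Ioc (0 : ℝ) 1)) =
      ENNReal.ofReal a⁻¹ • volume.restrict (Ioc 0 a) := by
  have hm : MeasurableEmbedding (fun x : ℝ => a * x) :=
    (Homeomorph.mulLeft₀ a ha.ne').measurableEmbedding
  have hpre : (fun x : ℝ => a * x) ⁻¹' Ioc 0 a = Ioc 0 1 := by
    ext x
    simp only [mem_preimage, mem_Ioc]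
    constructor
    · rintro ⟨h1, h2⟩
      exact ⟨(mul_pos_iff_of_pos_left ha).mp h1, by nlinarith⟩
    · rintro ⟨h1, h2⟩
      exact ⟨by positivity, by nlinarith⟩
  rw [← hpre, ← hm.restrict_map, Real.map_volume_mul_left ha.ne', Measure.restrict_smul,
    abs_of_pos (inv_pos.mpr ha)]

/-- The parametrization of the period cell by the unit torus. -/
noncomputable def cellParam (α : ℝ) (t : Fin 2 → UnitAddCircle) : ℝ × ℝ :=
  (2 * Real.pi / α * unitRep (t 0), 2 * Real.pi * unitRep (t 1))

lemma measurable_cellParam (α : ℝ) : Measurable (cellParam α) := by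
  have := measurePreserving_unitRep.measurable
  unfold cellParam
  fun_prop

lemma torusMeasure_eq (α : ℝ) :
    torusMeasure α = (volume.restrict (Ioc 0 (2 * Real.pi / α))).prod
      (volume.restrict (Ioc 0 (2 * Real.pi))) := by
  rw [torusMeasure, cell, Measure.volume_eq_prod, ← Measure.prod_restrict,
    restrict_Ioc_eq_restrict_Icc, restrict_Ioc_eq_restrict_Icc]

/-- The factor is the reciprocal of the area `4π²/α` of the cell. -/
lemma map_cellParam {α : ℝ} (hα : 0 < α) :
    Measure.map (cellParam α) unitTorusMeasure =
      ENNReal.ofReal (α / (4 * Real.pi ^ 2)) • torusMeasure α := by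
  have hA : 0 < 2 * Real.pi / α := by positivity
  have hB : 0 < 2 * Real.pi := by positivity
  have h1 : MeasurePreserving (fun t : UnitAddCircle => 2 * Real.pi / α * unitRep t)
      AddCircle.haarAddCircle
      (ENNReal.ofReal (2 * Real.pi / α)⁻¹ • volume.restrict (Ioc 0 (2 * Real.pi / α))) :=
    MeasurePreserving.comp ⟨measurable_const_mul _, map_mul_left_restrict_Ioc hA⟩
      measurePreserving_unitRep
  have h2 : MeasurePreserving (fun t : UnitAddCircle => 2 * Real.pi * unitRep t)
      AddCircle.haarAddCircle
      (ENNReal.ofReal (2 * Real.pi)⁻¹ • volume.restrict (Ioc 0 (2 * Real.pi))) :=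
    MeasurePreserving.comp ⟨measurable_const_mul _, map_mul_left_restrict_Ioc hB⟩
      measurePreserving_unitRep
  have h := (h1.prod h2).comp
    (measurePreserving_finTwoArrow (AddCircle.haarAddCircle : Measure UnitAddCircle))
  have e := h.map_eq
  rw [Measure.prod_smul_left, Measure.prod_smul_right, smul_smul, ← torusMeasure_eq,
    ← ENNReal.ofReal_mul (by positivity)] at e
  have e2 : (2 * Real.pi / α)⁻¹ * (2 * Real.pi)⁻¹ = α / (4 * Real.pi ^ 2) := by
    field_simp; norm_num
  rw [e2] at e
  exact e

instance (α : ℝ) : IsFiniteMeasure (torusMeasure α) := by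
  rw [torusMeasure_eq]; infer_instance

lemma integral_comp_cellParam {α : ℝ} (hα : 0 < α) {F : ℝ × ℝ → ℂ}
    (hF : AEStronglyMeasurable F (torusMeasure α)) :
    ∫ t, F (cellParam α t) ∂unitTorusMeasure =
      (α / (4 * Real.pi ^ 2) : ℝ) * ∫ x, F x ∂(torusMeasure α) := by
  have h := integral_map (μ := unitTorusMeasure) (measurable_cellParam α).aemeasurable (f := F)
    (by rw [map_cellParam hα]; exact hF.smul_measure _)
  rw [← h, map_cellParam hα, integral_smul_measure, ENNReal.toReal_ofReal (by positivity)]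
  rfl

/-- The exponentials on the elongated torus. -/
noncomputable def torusExp (α : ℝ) (k : ℤ × ℤ) (x : ℝ × ℝ) : ℂ :=
  Complex.exp (Complex.I * (α * k.1 * x.1 + k.2 * x.2))

lemma norm_torusExp (α : ℝ) (k : ℤ × ℤ) (x : ℝ × ℝ) : ‖torusExp α k x‖ = 1 := by
  unfold torusExp
  rw [Complex.norm_exp]
  simp

lemma continuous_torusExp (α : ℝ) (k : ℤ × ℤ) : Continuous (torusExp α k) := by
  unfold torusExp; fun_prop

lemma conj_torusExp (α : ℝ) (k : ℤ × ℤ) (x : ℝ × ℝ) :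
    conj (torusExp α k x) = torusExp α (-k) x := by
  unfold torusExp
  rw [← Complex.exp_conj]
  congr 1
  simp
  ring

lemma torusExp_cellParam {α : ℝ} (hα : 0 < α) (k : ℤ × ℤ) (t : Fin 2 → UnitAddCircle) :
    torusExp α k (cellParam α t) = UnitAddTorus.mFourier ![k.1, k.2] t := by
  have h : t = fun i => ((unitRep (t i) : ℝ) : UnitAddCircle) := by
    ext i; exact (coe_unitRep (t i)).symm
  conv_rhs => rw [h]
  have hα' : (α : ℂ) ≠ 0 := by exact_mod_cast hα.ne'
  simp only [UnitAddTorus.mFourier, ContinuousMap.coe_mk, Fin.prod_univ_two, fourier_coe_apply,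
    torusExp, cellParam]
  rw [← Complex.exp_add]
  congr 1
  simp
  field_simp

lemma ae_eq_zero_of_mFourierCoeff {F : (Fin 2 → UnitAddCircle) → ℂ}
    (hF : MemLp F 2 unitTorusMeasure)
    (h : ∀ n : Fin 2 → ℤ, ∫ t, UnitAddTorus.mFourier (-n) t * F t ∂unitTorusMeasure = 0) :
    F =ᵐ[unitTorusMeasure] 0 := by
  have hc : ∀ n : Fin 2 → ℤ, UnitAddTorus.mFourierCoeff (hF.toLp F) n = 0 := fun n => by
    refine Eq.trans ?_ (h n)
    refine integral_congr_ae (μ := unitTorusMeasure) ?_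
    filter_upwards [hF.coeFn_toLp] with t ht
    rw [ht, smul_eq_mul]
  have hs : HasSum (fun n : Fin 2 → ℤ => ‖UnitAddTorus.mFourierCoeff (hF.toLp F) n‖ ^ 2)
      (∫ t, ‖hF.toLp F t‖ ^ 2 ∂unitTorusMeasure) :=
    UnitAddTorus.hasSum_sq_mFourierCoeff (d := Fin 2) (hF.toLp F)
  simp only [hc, norm_zero, ne_eq, OfNat.ofNat_ne_zero, not_false_eq_true, zero_pow] at hs
  have hz := hs.unique hasSum_zero
  rw [integral_eq_zero_iff_of_nonneg (fun t => by positivity)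
    ((memLp_two_iff_integrable_sq_norm (Lp.aestronglyMeasurable _)).mp (Lp.memLp _))] at hz
  filter_upwards [hz, hF.coeFn_toLp] with t ht ht2
  rw [← ht2]
  simpa using ht

/-- Completeness is pulled back along `cellParam`, under which exponentials become Fourier
monomials; the push-forward measure and `torusMeasure α` have the same null sets. -/
lemma ae_eq_zero_of_torusExp {α : ℝ} (hα : 0 < α) {F : ℝ × ℝ → ℂ} (hF : MemLp F 2 (torusMeasure α))
    (h : ∀ k : ℤ × ℤ, ∫ x, torusExp α (-k) x * F x ∂(torusMeasure α) = 0) :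
    F =ᵐ[torusMeasure α] 0 := by
  have hmap : Measure.map (cellParam α) unitTorusMeasure ≪ torusMeasure α := by
    rw [map_cellParam hα]; exact Measure.smul_absolutelyContinuous
  have hmap' : torusMeasure α ≪ Measure.map (cellParam α) unitTorusMeasure := by
    rw [map_cellParam hα]
    exact Measure.absolutelyContinuous_smul (by
      rw [Ne, ENNReal.ofReal_eq_zero, not_le]; positivity)
  have hFm : MemLp F 2 (Measure.map (cellParam α) unitTorusMeasure) := by
    rw [map_cellParam hα]
    exact hF.smul_measure ENNReal.ofReal_ne_top
  have hc : MemLp (F ∘ cellParam α) 2 unitTorusMeasure :=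
    hFm.comp_of_map (measurable_cellParam α).aemeasurable
  have hz := ae_eq_zero_of_mFourierCoeff hc fun n => by
    have h1 := integral_comp_cellParam hα (F := fun x => torusExp α (-(n 0, n 1)) x * F x)
      ((continuous_torusExp α _).aestronglyMeasurable.mul hF.1)
    rw [h, mul_zero] at h1
    rw [← h1]
    congr 1
    ext t
    rw [torusExp_cellParam hα]
    congr 3
    ext i
    fin_cases i <;> rfl
  refine hmap'.ae_le ?_
  have hset : NullMeasurableSet {x | F x = 0} (Measure.map (cellParam α) unitTorusMeasure) :=
    nullMeasurableSet_eq_fun hFm.1.aemeasurable aemeasurable_const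
  change Measure.map (cellParam α) unitTorusMeasure {x | F x = 0}ᶜ = 0
  rw [Measure.map_apply₀ (measurable_cellParam α).aemeasurable hset.compl]
  exact hz

lemma integral_torusExp_mul {α : ℝ} (hα : 0 < α) (i j : ℤ × ℤ) :
    ∫ x, torusExp α (-i) x * torusExp α j x ∂(torusMeasure α) =
      if i = j then ((4 * Real.pi ^ 2 / α : ℝ) : ℂ) else 0 := by
  have h1 := integral_comp_cellParam hα (F := fun x => torusExp α (-i) x * torusExp α j x)
    ((continuous_torusExp α _).mul (continuous_torusExp α _)).aestronglyMeasurable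
  have h2 := orthonormal_iff_ite.mp (UnitAddTorus.orthonormal_mFourier (d := Fin 2))
    ![i.1, i.2] ![j.1, j.2]
  rw [ContinuousMap.inner_toLp] at h2
  have h3 : ∫ t, torusExp α (-i) (cellParam α t) * torusExp α j (cellParam α t) ∂unitTorusMeasure
      = if i = j then 1 else 0 := by
    have : (![i.1, i.2] = ![j.1, j.2]) ↔ i = j := by
      rw [Prod.ext_iff]; simp
    simp only [this] at h2
    rw [← h2]
    refine integral_congr_ae (.of_forall fun t => ?_)
    simp only
    rw [← conj_torusExp, torusExp_cellParam hα, torusExp_cellParam hα, mul_comm]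
  rw [h3] at h1
  have hc : ((α / (4 * Real.pi ^ 2) : ℝ) : ℂ) ≠ 0 := by
    have : α / (4 * Real.pi ^ 2) ≠ 0 := by positivity
    exact_mod_cast this
  rw [← mul_right_inj' hc, ← h1]
  split_ifs
  · rw [← Complex.ofReal_mul]
    have : α / (4 * Real.pi ^ 2) * (4 * Real.pi ^ 2 / α) = 1 := by field_simp
    rw [this]; simp
  · simp

lemma memLp_torusExp (α : ℝ) (k : ℤ × ℤ) : MemLp (torusExp α k) 2 (torusMeasure α) :=
  MemLp.of_bound (continuous_torusExp α k).aestronglyMeasurable 1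
    (.of_forall fun x => (norm_torusExp α k x).le)

/-- The normalized exponentials as elements of `L²`. -/
noncomputable def torusVec (α : ℝ) (k : ℤ × ℤ) : Lp ℂ 2 (torusMeasure α) :=
  ((√(α / (4 * Real.pi ^ 2)) : ℝ) : ℂ) • (memLp_torusExp α k).toLp

lemma inner_toLp_toLp {Ω : Type*} [MeasurableSpace Ω] {μ : Measure Ω} {f g : Ω → ℂ}
    (hf : MemLp f 2 μ) (hg : MemLp g 2 μ) :
    inner ℂ hf.toLp hg.toLp = ∫ x, g x * conj (f x) ∂μ := by
  rw [L2.inner_def]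
  refine integral_congr_ae ?_
  filter_upwards [hf.coeFn_toLp, hg.coeFn_toLp] with x h1 h2
  rw [h1, h2]
  rfl

lemma inner_torusVec (α : ℝ) (k : ℤ × ℤ) {f : ℝ × ℝ → ℂ} (hf : MemLp f 2 (torusMeasure α)) :
    inner ℂ (torusVec α k) hf.toLp =
      (√(α / (4 * Real.pi ^ 2)) : ℝ) * ∫ x, f x * torusExp α (-k) x ∂(torusMeasure α) := by
  rw [torusVec, inner_smul_left, inner_toLp_toLp, Complex.conj_ofReal]
  simp_rw [conj_torusExp]

lemma orthonormal_torusVec {α : ℝ} (hα : 0 < α) : Orthonormal ℂ (torusVec α) := by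
  rw [orthonormal_iff_ite]
  intro i j
  rw [torusVec, torusVec, inner_smul_left, inner_smul_right, inner_toLp_toLp, Complex.conj_ofReal]
  simp_rw [conj_torusExp, mul_comm (torusExp α j _)]
  rw [integral_torusExp_mul hα]
  have hs : √(α / (4 * Real.pi ^ 2)) * √(α / (4 * Real.pi ^ 2)) = α / (4 * Real.pi ^ 2) :=
    Real.mul_self_sqrt (by positivity)
  split_ifs
  · rw [← mul_assoc, ← Complex.ofReal_mul, hs, ← Complex.ofReal_mul]
    have : α / (4 * Real.pi ^ 2) * (4 * Real.pi ^ 2 / α) = 1 := by field_simp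
    rw [this]; simp
  · simp

lemma span_torusVec_orthogonal {α : ℝ} (hα : 0 < α) :
    (Submodule.span ℂ (range (torusVec α)))ᗮ = ⊥ := by
  rw [Submodule.eq_bot_iff]
  intro f hf
  have hs : (√(α / (4 * Real.pi ^ 2)) : ℂ) ≠ 0 := by
    have : √(α / (4 * Real.pi ^ 2)) ≠ 0 := (Real.sqrt_pos.mpr (by positivity)).ne'
    exact_mod_cast this
  have h0 : ∀ k, ∫ x, torusExp α (-k) x * f x ∂(torusMeasure α) = 0 := by
    intro k
    have h := Submodule.inner_right_of_mem_orthogonal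
      (Submodule.subset_span (mem_range_self k)) hf
    rw [← Lp.toLp_coeFn f (Lp.memLp f), inner_torusVec] at h
    simp_rw [mul_comm (torusExp α (-k) _)]
    exact (mul_eq_zero.mp h).resolve_left hs
  exact (Lp.eq_zero_iff_ae_eq_zero).mpr (ae_eq_zero_of_torusExp hα (Lp.memLp f) h0)

/-- The Hilbert basis of normalized exponentials on the elongated torus. -/
noncomputable def torusBasis {α : ℝ} (hα : 0 < α) :
    HilbertBasis (ℤ × ℤ) ℂ (Lp ℂ 2 (torusMeasure α)) :=
  HilbertBasis.mkOfOrthogonalEqBot (orthonormal_torusVec hα) (span_torusVec_orthogonal hα)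

lemma torusBasis_apply {α : ℝ} (hα : 0 < α) (k : ℤ × ℤ) : torusBasis hα k = torusVec α k := by
  rw [torusBasis, HilbertBasis.coe_mkOfOrthogonalEqBot]

lemma norm_torusBasis_sq_le {α : ℝ} (hα : 0 < α) (k : ℤ × ℤ) :
    ∀ᵐ x ∂(torusMeasure α), ‖torusBasis hα k x‖ ^ 2 ≤ α / (4 * Real.pi ^ 2) := by
  rw [torusBasis_apply]
  filter_upwards [Lp.coeFn_smul ((√(α / (4 * Real.pi ^ 2)) : ℝ) : ℂ) (memLp_torusExp α k).toLp,
    (memLp_torusExp α k).coeFn_toLp] with x h1 h2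
  rw [torusVec, h1, Pi.smul_apply, h2, norm_smul, norm_torusExp, mul_one, Complex.norm_real,
    Real.norm_eq_abs, sq_abs, Real.sq_sqrt (by positivity)]

/-! ### Dirichlet energy in Fourier coefficients, and the conclusion. -/

lemma fderiv_torusExp_apply (α : ℝ) (k : ℤ × ℤ) (x v : ℝ × ℝ) :
    fderiv ℝ (torusExp α k) x v =
      torusExp α k x * (Complex.I * (α * k.1 * v.1 + k.2 * v.2)) := by
  have h1 : HasFDerivAt (fun x : ℝ × ℝ => (x.1 : ℂ))
      (Complex.ofRealCLM.comp (ContinuousLinearMap.fst ℝ ℝ ℝ)) x :=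
    (Complex.ofRealCLM.comp (ContinuousLinearMap.fst ℝ ℝ ℝ)).hasFDerivAt
  have h2 : HasFDerivAt (fun x : ℝ × ℝ => (x.2 : ℂ))
      (Complex.ofRealCLM.comp (ContinuousLinearMap.snd ℝ ℝ ℝ)) x :=
    (Complex.ofRealCLM.comp (ContinuousLinearMap.snd ℝ ℝ ℝ)).hasFDerivAt
  have h := (((h1.const_mul ((α : ℂ) * k.1)).add (h2.const_mul (k.2 : ℂ))).const_mul
    Complex.I).cexp
  have h' : HasFDerivAt (torusExp α k) _ x := h
  rw [h'.fderiv]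
  simp [torusExp]
  ring

lemma isTestFunction_torusExp {α : ℝ} (hα : 0 < α) (k : ℤ × ℤ) :
    IsTestFunction α (torusExp α k) where
  smooth := by
    have h1 : ContDiff ℝ ∞ (fun x : ℝ × ℝ => (x.1 : ℂ)) :=
      Complex.ofRealCLM.contDiff.comp contDiff_fst
    have h2 : ContDiff ℝ ∞ (fun x : ℝ × ℝ => (x.2 : ℂ)) :=
      Complex.ofRealCLM.contDiff.comp contDiff_snd
    unfold torusExp
    fun_prop
  periodic_fst x := by
    have hα' : (α : ℂ) ≠ 0 := by exact_mod_cast hα.ne'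
    unfold torusExp
    rw [Complex.exp_eq_exp_iff_exists_int]
    refine ⟨k.1, ?_⟩
    push_cast
    field_simp
    ring
  periodic_snd x := by
    unfold torusExp
    rw [Complex.exp_eq_exp_iff_exists_int]
    refine ⟨k.2, ?_⟩
    push_cast
    ring

/-- Parseval's identity gives the Dirichlet energy in terms of Fourier coefficients. -/
lemma IsSobolev.tsum_eigenvalue_mul {α : ℝ} (hα : 0 < α) {ψ g₁ g₂ : ℝ × ℝ → ℂ}
    (h : IsSobolev α ψ g₁ g₂) :
    ∑' k, ENNReal.ofReal (eigenvalue α k) * ‖inner ℂ (torusBasis hα k) h.memLp.toLp‖ₑ ^ 2 =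
      ∫⁻ x, (‖g₁ x‖ₑ ^ 2 + ‖g₂ x‖ₑ ^ 2) ∂(torusMeasure α) := by
  -- Testing the weak derivative against the conjugate exponential multiplies the coefficient of `ψ`
  -- by `-i r`. Here `r` is a frequency of `-k`; its sign disappears in the square.
  have hcoef : ∀ (k : ℤ × ℤ) (r : ℝ) (g : ℝ × ℝ → ℂ) (hg : MemLp g 2 (torusMeasure α)),
      ∫ x, ψ x * (torusExp α (-k) x * (Complex.I * r)) ∂(torusMeasure α) =
        -∫ x, g x * torusExp α (-k) x ∂(torusMeasure α) →
      ‖inner ℂ (torusBasis hα k) hg.toLp‖ₑ ^ 2 =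
        ENNReal.ofReal (r ^ 2) * ‖inner ℂ (torusBasis hα k) h.memLp.toLp‖ₑ ^ 2 := by
    intro k r g hg heq
    have e : inner ℂ (torusBasis hα k) hg.toLp =
        (-(Complex.I * r)) * inner ℂ (torusBasis hα k) h.memLp.toLp := by
      rw [torusBasis_apply, inner_torusVec, inner_torusVec]
      simp_rw [← mul_assoc (ψ _)] at heq
      rw [integral_mul_const] at heq
      linear_combination (√(α / (4 * Real.pi ^ 2)) : ℂ) * heq
    rw [e, enorm_mul, mul_pow]
    congr 1
    rw [← ofReal_norm, ← ENNReal.ofReal_pow (norm_nonneg _), norm_neg, norm_mul, Complex.norm_I,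
      one_mul, Complex.norm_real, Real.norm_eq_abs, sq_abs]
  have hnorm : ∀ (g : ℝ × ℝ → ℂ) (hg : MemLp g 2 (torusMeasure α)),
      ∑' k, ‖inner ℂ (torusBasis hα k) hg.toLp‖ₑ ^ 2 = ∫⁻ x, ‖g x‖ₑ ^ 2 ∂(torusMeasure α) := by
    intro g hg
    rw [tsum_enorm_inner_sq, ← lintegral_enorm_sq]
    refine lintegral_congr_ae ?_
    filter_upwards [hg.coeFn_toLp] with x hx
    rw [hx]
  rw [lintegral_add_left' (h.memLp_fst.1.enorm.pow_const 2), ← hnorm g₁ h.memLp_fst,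
    ← hnorm g₂ h.memLp_snd, ← ENNReal.tsum_add]
  refine tsum_congr fun k => ?_
  have h1 := h.weak_fst _ (isTestFunction_torusExp hα (-k))
  have h2 := h.weak_snd _ (isTestFunction_torusExp hα (-k))
  simp_rw [fderiv_torusExp_apply] at h1 h2
  rw [hcoef k (α * (-k).1) g₁ h.memLp_fst (by rw [← h1]; simp),
    hcoef k (-k).2 g₂ h.memLp_snd (by rw [← h2]; simp), ← add_mul,
    ← ENNReal.ofReal_add (by positivity) (by positivity)]
  congr 2
  unfold eigenvalue
  simp

lemma eigenvalue_pos {α : ℝ} (hα : 0 < α) {k : ℤ × ℤ} (hk : k ≠ 0) : 0 < eigenvalue α k := by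
  unfold eigenvalue
  rcases eq_or_ne k.1 0 with h1 | h1
  · have h2 : k.2 ≠ 0 := fun h2 => hk (Prod.ext h1 h2)
    positivity
  · positivity

theorem liebThirringInequality {α : ℝ} (hα₀ : 0 < α) (hα₁ : α ≤ 1) :
    LiebThirringInequality α (ENNReal.ofReal (1 / α * (3 * Real.pi / 32))) := by
  intro N ψ g₁ g₂ h
  set P : Fin N → Lp ℂ 2 (torusMeasure α) := fun j => (h.sobolev j).memLp.toLp
  have hP : Orthonormal ℂ P := by
    rw [orthonormal_iff_ite]
    intro i j
    rw [inner_toLp_toLp, h.orthonormal j i]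
    simp only [eq_comm]
  have h0 : ∀ j, inner ℂ (torusBasis hα₀ 0) (P j) = 0 := by
    intro j
    rw [torusBasis_apply, inner_torusVec]
    simp [torusExp, h.mean_zero j]
  -- The value of `A` is the product of the sup bound `α/(4π²)` of the squared basis functions and
  -- the lattice constant `π²/(4α²)`.
  have hmain := lintegral_density_sq_le (torusBasis hα₀) (norm_torusBasis_sq_le hα₀)
    (eigenvalue α) 0 (fun k hk => eigenvalue_pos hα₀ hk) (A := 1 / (16 * α)) (by positivity)
    (fun ν hν K hK => by
      calc α / (4 * Real.pi ^ 2) * ∑ k ∈ K, (1 + eigenvalue α k ^ 2 / ν ^ 2)⁻¹ ^ 2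
          ≤ α / (4 * Real.pi ^ 2) * (Real.pi ^ 2 / (4 * α ^ 2) * ν) := by
            gcongr
            exact sum_eigenvalue_le hα₀ hα₁ hν K hK
        _ = 1 / (16 * α) * ν := by field_simp; norm_num)
    hP h0
  have hc : 6 * (1 / (16 * α)) * (Real.pi / 4) = 1 / α * (3 * Real.pi / 32) := by
    field_simp; norm_num
  rw [hc] at hmain
  have hl : ∫⁻ x, (∑ j, ‖ψ j x‖ₑ ^ 2) ^ 2 ∂(torusMeasure α) =
      ∫⁻ x, (∑ j, ‖P j x‖ₑ ^ 2) ^ 2 ∂(torusMeasure α) := by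
    refine lintegral_congr_ae ?_
    have : ∀ᵐ x ∂(torusMeasure α), ∀ j, P j x = ψ j x :=
      ae_all_iff.mpr fun j => (h.sobolev j).memLp.coeFn_toLp
    filter_upwards [this] with x hx
    simp only [hx]
  rw [hl]
  refine hmain.trans_eq ?_
  congr 1
  exact Finset.sum_congr rfl fun j _ => (h.sobolev j).tsum_eigenvalue_mul hα₀

end LiebThirring

theorem theorem3p1 (α : ℝ) (hα₀ : 0 < α) (hα₁ : α ≤ 1) :
    LiebThirring.LiebThirringInequality α (ENNReal.ofReal (1 / α * (3 * Real.pi / 32))) ∧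
      LiebThirring.kLT α ≤ ENNReal.ofReal (1 / α * (3 * Real.pi / 32)) :=
  ⟨LiebThirring.liebThirringInequality hα₀ hα₁,
    sInf_le (LiebThirring.liebThirringInequality hα₀ hα₁)⟩
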